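/- Let $k\in\mathbb R$ with $k\neq-2$ and $k\neq-\tfrac32$. For symmetric $3\times3$ matrix fields (or matrices of tempered distributions) $Q$ on $\mathbb R^3$ put $(\operatorname{div}Q)_j=\sum_l\partial_lQ_{lj}$ and $$(\mathcal D^*Q)_{ij}=-\Delta Q_{ij}-\tfrac k2\Big(\partial_i(\operatorname{div}Q)_j+\partial_j(\operatorname{div}Q)_i-\tfrac23\,\partial_i\partial_j\operatorname{Tr}Q\Big).$$ Identify symmetric matrices with six-vectors by the ordering $(1,1),(2,2),(3,3),(1,2),(1,3),(2,3)$ of the symmetric index pairs, and let $e_{pq}$ be the corresponding unit vectors (so $e_{12}$ is the symmetric matrix with entries $1$ at $(1,2)$ and $(2,1)$ and $0$ elsewhere). Write $(x_1,x_2,x_3)=(x,y,z)$, $r^2=x^2+y^2+z^2$, and let $F^{pq}_{ij}$ be $\dfrac{1}{32\pi(2+k)(3+2k)r^5}$ times the numerator $P^{pq}_{ij}$ given as follows. For $p=q$, and distinct indices $p,a,b$: $$\begin{aligned} P^{pp}_{pp}&=(48+40k+4k^2)r^4+(16k+12k^2)r^2x_p^2+3k^2(x_a^2+x_b^2)^2,\\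 P^{pp}_{aa}&=r^2\big((8k+4k^2)x_p^2+(8k+5k^2)x_b^2\big)+3k^2x_p^2x_a^2,\\ P^{pp}_{pa}&=(4k+k^2)r^2x_px_a+3k^2x_p^3x_a,\qquad P^{pp}_{ab}=-(8k+5k^2)r^2x_ax_b+3k^2x_p^2x_ax_b . \end{aligned}$$ For $p\ne q$, and $s$ the third index: $$\begin{aligned} P^{pq}_{pp}&=(24k+10k^2)r^2x_px_q+6k^2x_p^3x_q,\qquad P^{pq}_{qq}=(24k+10k^2)r^2x_px_q+6k^2x_px_q^3,\\ P^{pq}_{ss}&=-2k^2r^2x_px_q+6k^2x_px_qx_s^2,\\ P^{pq}_{pq}&=(48+44k+8k^2)r^4-(12k+6k^2)r^2x_s^2+6k^2x_p^2x_q^2,\\ P^{pq}_{ps}&=(12k+6k^2)r^2x_qx_s+6k^2x_p^2x_qx_s,\qquad P^{pq}_{qs}=(12k+6k^2)r^2x_px_s+6k^2x_px_q^2x_s . \end{aligned}$$ Use the Fourier convention $\hat f(\xi)=\int f(x)e^{-ix\cdot\xi}\,dx$, in the sense of tempered distributions. Then: 1. Every $P^{pq}_{ij}$ is a homogeneous polynomial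 of degree $4$ in $(x,y,z)$. 2. Every $F^{pq}_{ij}$ defines, by integration against Schwartz functions, a tempered distribution, and $\mathcal D^*F^{pq}=\delta_0\,e_{pq}$ in the sense of distributions, for each of the six index pairs. 3. On symmetric matrix fields $\mathcal D^*$ has as Fourier symbol the $6\times6$ matrix $$N^*(\xi)=\begin{pmatrix} |\xi|^2+\frac{2k}3\xi_1^2&-\frac k3\xi_1^2&-\frac k3\xi_1^2&k\xi_1\xi_2&k\xi_1\xi_3&0\\ -\frac k3\xi_2^2&|\xi|^2+\frac{2k}3\xi_2^2&-\frac k3\xi_2^2&k\xi_1\xi_2&0&k\xi_2\xi_3\\ -\frac k3\xi_3^2&-\frac k3\xi_3^2&|\xi|^2+\frac{2k}3\xi_3^2&0&k\xi_1\xi_3&k\xi_2\xi_3\\ \frac k6\xi_1\xi_2&\frac k6\xi_1\xi_2&-\frac k3\xi_1\xi_2&|\xi|^2+\frac k2(\xi_1^2+\xi_2^2)&\frac k2\xi_2\xi_3&\frac k2\xi_1\xi_3\\ \frac k6\xi_1\xi_3&-\frac k3\xi_1\xi_3&\frac k6\xi_1\xi_3&\frac k2\xi_2\xi_3&|\xi|^2+\frac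 k2(\xi_1^2+\xi_3^2)&\frac k2\xi_1\xi_2\\ -\frac k3\xi_2\xi_3&\frac k6\xi_2\xi_3&\frac k6\xi_2\xi_3&\frac k2\xi_1\xi_3&\frac k2\xi_1\xi_2&|\xi|^2+\frac k2(\xi_2^2+\xi_3^2) \end{pmatrix}.$$ It is invertible for every $\xi\ne0$, and each entry of $N^*(\xi)^{-1}$ is a homogeneous quartic polynomial in $\xi$ divided by $(2+k)(3+2k)|\xi|^6$. 4. Up to permutations of the coordinates, the inverse Fourier transforms of $\xi^\alpha/|\xi|^6$, $|\alpha|=4$, are $$\begin{aligned} \frac{\xi_1^3\xi_2}{|\xi|^6}&\mapsto\frac{-3xy(y^2+z^2)}{32\pi r^5},& \frac{\xi_1^2\xi_2\xi_3}{|\xi|^6}&\mapsto\frac{yz(2x^2-y^2-z^2)}{32\pi r^5},\\ \frac{\xi_1^4}{|\xi|^6}&\mapsto\frac{3(y^2+z^2)^2}{32\pi r^5},& \frac{\xi_1^2\xi_2^2}{|\xi|^6}&\mapsto\frac{3x^2y^2+r^2z^2}{32\pi r^5}, \end{aligned}$$ and the Fourier transform of $F^{pq}$ is $N^*(\xi)^{-1}e_{pq}$.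 5. For $k=0$, $F^{pq}=\dfrac1{4\pi r}\,e_{pq}$ on $\mathbb R^3\setminus\{0\}$. -/

import Mathlib

open MeasureTheory SchwartzMap LineDeriv Laplacian FourierTransform

namespace LiquidCrystal

/-- Euclidean three-space. -/
abbrev E3 : Type := EuclideanSpace ℝ (Fin 3)

/-- The standard basis vector `e_i`, so that `∂_{e i}` is the `i`-th partial derivative. -/
noncomputable abbrev e (i : Fin 3) : E3 := EuclideanSpace.single i (1 : ℝ)

/-- The six symmetric index pairs, in the order (1,1), (2,2), (3,3), (1,2), (1,3), (2,3)
(indices are shifted by one: `Fin 3 = {0, 1, 2}`). -/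
def pair : Fin 6 → Fin 3 × Fin 3 :=
  ![(0, 0), (1, 1), (2, 2), (0, 1), (0, 2), (1, 2)]

/-- The symmetric 3×3 matrix whose entries at the six index pairs are the components of a
six-vector. -/
def symMat {V : Type*} (q : Fin 6 → V) : Matrix (Fin 3) (Fin 3) V :=
  !![q 0, q 3, q 4;
     q 3, q 1, q 5;
     q 4, q 5, q 2]

section Operator

variable {V : Type*} [AddCommGroup V] [Module ℝ V] [LineDeriv E3 V V] [Laplacian V V]

/-- The divergence `(div Q)_j = ∑ₗ ∂ₗ Q_{lj}` of a matrix field. -/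
noncomputable def matDiv (Q : Matrix (Fin 3) (Fin 3) V) (j : Fin 3) : V :=
  ∑ l, ∂_{e l} (Q l j)

/-- The operator
`(D* Q)_{ij} = -Δ Q_{ij} - (k/2) (∂ᵢ (div Q)ⱼ + ∂ⱼ (div Q)ᵢ - (2/3) ∂ᵢ ∂ⱼ Tr Q)`,
for matrix fields with entries in any space with partial derivatives
(used for Schwartz functions and for tempered distributions). -/
noncomputable def adjointOp (k : ℝ) (Q : Matrix (Fin 3) (Fin 3) V) :
    Matrix (Fin 3) (Fin 3) V :=
  Matrix.of fun i j =>
    -(Δ (Q i j)) - (k / 2) • (∂_{e i} (matDiv Q j) + ∂_{e j} (matDiv Q i)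
      - (2 / 3 : ℝ) • ∂_{e i} (∂_{e j} Q.trace))

end Operator

/-- The 6×6 Fourier symbol `N*(ξ)` of `D*` acting on symmetric matrices, in the ordering of
`pair`; here `∂ⱼ` corresponds to multiplication by `i ξⱼ`. -/
noncomputable def symbol (k : ℝ) (ξ : E3) : Matrix (Fin 6) (Fin 6) ℝ :=
  let a := ξ 0
  let b := ξ 1
  let c := ξ 2
  let n := a ^ 2 + b ^ 2 + c ^ 2
  !![n + 2 * k / 3 * a ^ 2, -(k / 3) * a ^ 2, -(k / 3) * a ^ 2, k * a * b, k * a * c, 0;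
     -(k / 3) * b ^ 2, n + 2 * k / 3 * b ^ 2, -(k / 3) * b ^ 2, k * a * b, 0, k * b * c;
     -(k / 3) * c ^ 2, -(k / 3) * c ^ 2, n + 2 * k / 3 * c ^ 2, 0, k * a * c, k * b * c;
     k / 6 * a * b, k / 6 * a * b, -(k / 3) * a * b,
       n + k / 2 * (a ^ 2 + b ^ 2), k / 2 * b * c, k / 2 * a * c;
     k / 6 * a * c, -(k / 3) * a * c, k / 6 * a * c,
       k / 2 * b * c, n + k / 2 * (a ^ 2 + c ^ 2), k / 2 * a * b;
     -(k / 3) * b * c, k / 6 * b * c, k / 6 * b * c,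
       k / 2 * a * c, k / 2 * a * b, n + k / 2 * (b ^ 2 + c ^ 2)]

/-- The numerators of the components of `F^{11}`, where `K = k` and `r2 = r² = x² + y² + z²`. -/
def num11 {R : Type*} [CommRing R] (K x y z : R) : Fin 6 → R :=
  let r2 : R := x ^ 2 + y ^ 2 + z ^ 2
  ![r2 ^ 2 * (48 + 40 * K + 4 * K ^ 2) + r2 * (x ^ 2 * (16 * K + 12 * K ^ 2)) + 3 * K ^ 2 * (y ^ 2 + z ^ 2) ^ 2,
    r2 * (x ^ 2 * (8 * K + 4 * K ^ 2) + z ^ 2 * (8 * K + 5 * K ^ 2)) + 3 * K ^ 2 * x ^ 2 * y ^ 2,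
    r2 * (x ^ 2 * (8 * K + 4 * K ^ 2) + y ^ 2 * (8 * K + 5 * K ^ 2)) + 3 * K ^ 2 * x ^ 2 * z ^ 2,
    r2 * (x * y * (4 * K + K ^ 2)) + 3 * K ^ 2 * x ^ 3 * y,
    r2 * (x * z * (4 * K + K ^ 2)) + 3 * K ^ 2 * x ^ 3 * z,
    r2 * (y * z * (-8 * K - 5 * K ^ 2)) + 3 * K ^ 2 * x ^ 2 * y * z]

/-- The numerators of the components of `F^{22}`, where `K = k` and `r2 = r² = x² + y² + z²`. -/
def num22 {R : Type*} [CommRing R] (K x y z : R) : Fin 6 → R :=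
  let r2 : R := x ^ 2 + y ^ 2 + z ^ 2
  ![r2 * (y ^ 2 * (8 * K + 4 * K ^ 2) + z ^ 2 * (8 * K + 5 * K ^ 2)) + 3 * K ^ 2 * x ^ 2 * y ^ 2,
    r2 ^ 2 * (48 + 40 * K + 4 * K ^ 2) + r2 * (y ^ 2 * (16 * K + 12 * K ^ 2)) + 3 * K ^ 2 * (x ^ 2 + z ^ 2) ^ 2,
    r2 * (y ^ 2 * (8 * K + 4 * K ^ 2) + x ^ 2 * (8 * K + 5 * K ^ 2)) + 3 * K ^ 2 * y ^ 2 * z ^ 2,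
    r2 * (x * y * (4 * K + K ^ 2)) + 3 * K ^ 2 * x * y ^ 3,
    r2 * (x * z * (-8 * K - 5 * K ^ 2)) + 3 * K ^ 2 * x * y ^ 2 * z,
    r2 * (y * z * (4 * K + K ^ 2)) + 3 * K ^ 2 * y ^ 3 * z]

/-- The numerators of the components of `F^{33}`, where `K = k` and `r2 = r² = x² + y² + z²`. -/
def num33 {R : Type*} [CommRing R] (K x y z : R) : Fin 6 → R :=
  let r2 : R := x ^ 2 + y ^ 2 + z ^ 2
  ![r2 * (z ^ 2 * (8 * K + 4 * K ^ 2) + y ^ 2 * (8 * K + 5 * K ^ 2)) + 3 * K ^ 2 * x ^ 2 * z ^ 2,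
    r2 * (z ^ 2 * (8 * K + 4 * K ^ 2) + x ^ 2 * (8 * K + 5 * K ^ 2)) + 3 * K ^ 2 * y ^ 2 * z ^ 2,
    r2 ^ 2 * (48 + 40 * K + 4 * K ^ 2) + r2 * (z ^ 2 * (16 * K + 12 * K ^ 2)) + 3 * K ^ 2 * (x ^ 2 + y ^ 2) ^ 2,
    r2 * (x * y * (-8 * K - 5 * K ^ 2)) + 3 * K ^ 2 * x * y * z ^ 2,
    r2 * (x * z * (4 * K + K ^ 2)) + 3 * K ^ 2 * x * z ^ 3,
    r2 * (y * z * (4 * K + K ^ 2)) + 3 * K ^ 2 * y * z ^ 3]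

/-- The numerators of the components of `F^{12}`, where `K = k` and `r2 = r² = x² + y² + z²`. -/
def num12 {R : Type*} [CommRing R] (K x y z : R) : Fin 6 → R :=
  let r2 : R := x ^ 2 + y ^ 2 + z ^ 2
  ![r2 * (x * y * (24 * K + 10 * K ^ 2)) + 6 * K ^ 2 * x ^ 3 * y,
    r2 * (x * y * (24 * K + 10 * K ^ 2)) + 6 * K ^ 2 * x * y ^ 3,
    r2 * (x * y * (-2 * K ^ 2)) + 6 * K ^ 2 * x * y * z ^ 2,
    r2 ^ 2 * (48 + 44 * K + 8 * K ^ 2) + r2 * (z ^ 2 * (-12 * K - 6 * K ^ 2)) + 6 * K ^ 2 * x ^ 2 * y ^ 2,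
    r2 * (y * z * (12 * K + 6 * K ^ 2)) + 6 * K ^ 2 * x ^ 2 * y * z,
    r2 * (x * z * (12 * K + 6 * K ^ 2)) + 6 * K ^ 2 * x * y ^ 2 * z]

/-- The numerators of the components of `F^{13}`, where `K = k` and `r2 = r² = x² + y² + z²`. -/
def num13 {R : Type*} [CommRing R] (K x y z : R) : Fin 6 → R :=
  let r2 : R := x ^ 2 + y ^ 2 + z ^ 2
  ![r2 * (x * z * (24 * K + 10 * K ^ 2)) + 6 * K ^ 2 * x ^ 3 * z,
    r2 * (x * z * (-2 * K ^ 2)) + 6 * K ^ 2 * x * y ^ 2 * z,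
    r2 * (x * z * (24 * K + 10 * K ^ 2)) + 6 * K ^ 2 * x * z ^ 3,
    r2 * (y * z * (12 * K + 6 * K ^ 2)) + 6 * K ^ 2 * x ^ 2 * y * z,
    r2 ^ 2 * (48 + 44 * K + 8 * K ^ 2) + r2 * (y ^ 2 * (-12 * K - 6 * K ^ 2)) + 6 * K ^ 2 * x ^ 2 * z ^ 2,
    r2 * (x * y * (12 * K + 6 * K ^ 2)) + 6 * K ^ 2 * x * y * z ^ 2]

/-- The numerators of the components of `F^{23}`, where `K = k` and `r2 = r² = x² + y² + z²`. -/
def num23 {R : Type*} [CommRing R] (K x y z : R) : Fin 6 → R :=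
  let r2 : R := x ^ 2 + y ^ 2 + z ^ 2
  ![r2 * (y * z * (-2 * K ^ 2)) + 6 * K ^ 2 * x ^ 2 * y * z,
    r2 * (y * z * (24 * K + 10 * K ^ 2)) + 6 * K ^ 2 * y ^ 3 * z,
    r2 * (y * z * (24 * K + 10 * K ^ 2)) + 6 * K ^ 2 * y * z ^ 3,
    r2 * (x * z * (12 * K + 6 * K ^ 2)) + 6 * K ^ 2 * x * y ^ 2 * z,
    r2 * (x * y * (12 * K + 6 * K ^ 2)) + 6 * K ^ 2 * x * y * z ^ 2,
    r2 ^ 2 * (48 + 44 * K + 8 * K ^ 2) + r2 * (x ^ 2 * (-12 * K - 6 * K ^ 2)) + 6 * K ^ 2 * y ^ 2 * z ^ 2]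

/-- The numerators of all components of the six solutions, in the ordering of `pair`. -/
def numerator {R : Type*} [CommRing R] (K x y z : R) : Fin 6 → Fin 6 → R :=
  ![num11 K x y z, num22 K x y z, num33 K x y z, num12 K x y z, num13 K x y z, num23 K x y z]

/-- The numerator polynomials: `fundNum k p a` is the numerator of the component with index pair
`pair a` of the fundamental solution with index pair `pair p`. -/
noncomputable def fundNum (k : ℝ) (p a : Fin 6) : MvPolynomial (Fin 3) ℝ :=
  numerator (MvPolynomial.C k) (MvPolynomial.X 0) (MvPolynomial.X 1) (MvPolynomial.X 2) p a

/-- The component with index pair `pair a` of the fundamental solution `F^{pq}` with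
`(p,q) = pair p`: numerator over `32 π (2 + k) (3 + 2 k) r⁵`. -/
noncomputable def fundSol (k : ℝ) (p a : Fin 6) (x : E3) : ℝ :=
  MvPolynomial.eval (fun i => x i) (fundNum k p a) /
    (32 * Real.pi * (2 + k) * (3 + 2 * k) * ‖x‖ ^ 5)

/-- The tempered distribution `T` is integration against the function `f` (and `f` times any
Schwartz function is integrable). -/
def IsGivenBy (T : 𝓢'(E3, ℂ)) (f : E3 → ℝ) : Prop :=
  ∀ φ : 𝓢(E3, ℂ), Integrable (fun x => φ x * (f x : ℂ)) ∧ T φ = ∫ x, φ x * (f x : ℂ)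

/-- `g` is the Fourier transform of `f` in the sense of tempered distributions, in the
normalization `g(ξ) = ∫ f(x) exp(-i x·ξ) dx`, `f(x) = (2π)⁻³ ∫ g(ξ) exp(i x·ξ) dξ`.
Since `𝓕` uses the kernel `exp(-2πi x·η)`, this reads `(𝓕 f)(η) = g(2πη)`. -/
def IsFourierPair (f g : E3 → ℝ) : Prop :=
  ∃ T : 𝓢'(E3, ℂ), IsGivenBy T f ∧ IsGivenBy (𝓕 T) (fun η => g ((2 * Real.pi) • η))

end LiquidCrystal

/-! Everything reduces to one Fourier transform, that of the tensor `ξᵢ ξⱼ ξₖ ξₗ / |ξ|⁶`. It is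
obtained as a superposition of Gaussians of varying width `u`. Pairing a Gaussian with four
derivatives of `𝓕 φ` and integrating by parts gives a quartic Hermite polynomial times the Gaussian
on one side, and a monomial times the transformed Gaussian on the other
(`integral_fourier_mul_hermite_gauss`). Integrating against a power of `u` turns both sides into
Gamma integrals, and Fubini produces `kern` (`integral_fourier_mul_kern`). Only locally integrable
functions occur, so no regularization is needed.

The symbol sends `Q` to `|ξ|² Q + (k/2)(ξ ⊗ Qξ + Qξ ⊗ ξ - (2/3) Tr Q ξ ⊗ ξ)`. Solving for `Qξ`, `Tr
Q` and `ξ·Qξ` gives an inverse whose numerator is a fixed linear contraction, `quarticForm`, of `ξ ⊗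
ξ ⊗ ξ ⊗ ξ`; the only divisors are `2 + k`, `3 + 2k` and powers of `|ξ|`. By linearity the same
contraction of `kern` has the inverse symbol as Fourier transform, and a polynomial identity matches
it with the explicit table (`sum_mul_numerator`, `symbol_mul_quarticForm`).

The differential equation then follows on the Fourier side: tested against `𝓕 ψ`, the operator
multiplies the transform by the symbol, the symbol cancels its inverse almost everywhere, and `∫ ψ =
𝓕 ψ 0` is the delta (`adjointOp_eq_delta`). -/

namespace LiquidCrystal

/-! ### Singular functions as tempered distributions -/

/-- A function which is integrable after division by `(1 + |x|²) ^ n` is integrable against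
Schwartz functions and defines a tempered distribution. -/
theorem exists_isGivenBy_of_integrable {f : E3 → ℝ} (n : ℕ)
    (hf : Integrable fun x : E3 => ((1 + ‖x‖ ^ 2) ^ n)⁻¹ * f x) : ∃ T, IsGivenBy T f := by
  have hw : (fun x : E3 => (((1 + ‖x‖ ^ 2) ^ n : ℝ) : ℂ)).HasTemperateGrowth := by
    have : (fun x : E3 => ‖x‖ ^ 2).HasTemperateGrowth :=
      Function.hasTemperateGrowth_norm_sq E3
    have h1 : (fun x : E3 => (1 + ‖x‖ ^ 2) ^ n).HasTemperateGrowth := by fun_prop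
    exact (Function.HasTemperateGrowth.comp Function.Complex.hasTemperateGrowth_ofReal h1)
  have hL : MemLp (fun x : E3 => ((((1 + ‖x‖ ^ 2) ^ n)⁻¹ * f x : ℝ) : ℂ)) 1 :=
    memLp_one_iff_integrable.mpr hf.ofReal
  have key : ∀ φ : 𝓢(E3, ℂ), ∀ x, smulLeftCLM ℂ (fun x : E3 => (((1 + ‖x‖ ^ 2) ^ n : ℝ) : ℂ)) φ x *
      ((((1 + ‖x‖ ^ 2) ^ n)⁻¹ * f x : ℝ) : ℂ) = φ x * f x := by
    intro φ x
    have : ((1 + ‖x‖ ^ 2) ^ n : ℝ) ≠ 0 := by positivity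
    rw [smulLeftCLM_apply_apply hw, Complex.ofReal_mul, Complex.ofReal_inv, smul_eq_mul]
    have h2 := Complex.ofReal_ne_zero.mpr this
    field_simp
  -- The distribution is the weight `(1 + |x|²) ^ n` times that of the integrable quotient; the
  -- weight moves onto the test function.
  refine ⟨TemperedDistribution.smulLeftCLM ℂ (fun x : E3 => (((1 + ‖x‖ ^ 2) ^ n : ℝ) : ℂ))
    (Lp.toTemperedDistribution hL.toLp), fun φ => ⟨?_, ?_⟩⟩
  · simp_rw [← key φ]
    obtain ⟨C, hC⟩ : ∃ C, ∀ x,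
        ‖smulLeftCLM ℂ (fun x : E3 => (((1 + ‖x‖ ^ 2) ^ n : ℝ) : ℂ)) φ x‖ ≤ C :=
      ⟨_, norm_le_seminorm ℂ _⟩
    exact (memLp_one_iff_integrable.mp hL).bdd_mul
      (SchwartzMap.continuous _).aestronglyMeasurable (.of_forall hC)
  · rw [TemperedDistribution.smulLeftCLM_apply_apply, Lp.toTemperedDistribution_apply]
    refine integral_congr_ae ?_
    filter_upwards [hL.coeFn_toLp] with x hx
    rw [hx, ← key φ x, smul_eq_mul]

/-- In polar coordinates the Jacobian `r²` turns `(1 + r²)⁻² (1 + r⁻²)` into exactly `(1 + r²)⁻¹`.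
The bound covers homogeneity of degree `-1` (space side) as well as `-2` (Fourier side). -/
theorem integrable_weighted_of_le {f : E3 → ℝ} (hm : Measurable f) {C : ℝ}
    (hC : ∀ x, |f x| ≤ C * (1 + (‖x‖ ^ 2)⁻¹)) :
    Integrable fun x : E3 => ((1 + ‖x‖ ^ 2) ^ 2)⁻¹ * f x := by
  have h : Integrable fun x : E3 => C * (((1 + ‖x‖ ^ 2) ^ 2)⁻¹ * (1 + (‖x‖ ^ 2)⁻¹)) := by
    refine Integrable.const_mul ?_ C
    refine (integrable_fun_norm_addHaar (volume : Measure E3)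
      (f := fun r : ℝ => ((1 + r ^ 2) ^ 2)⁻¹ * (1 + (r ^ 2)⁻¹))).mpr ?_
    refine (integrable_inv_one_add_sq.integrableOn (s := Set.Ioi 0)).congr_fun ?_
      measurableSet_Ioi
    intro r hr
    have hr : (0 : ℝ) < r := hr
    simp only [finrank_euclideanSpace, Fintype.card_fin, smul_eq_mul]
    norm_num
    field_simp
    ring
  refine h.mono' (by fun_prop) (.of_forall fun x => ?_)
  rw [norm_mul, Real.norm_of_nonneg (by positivity : (0 : ℝ) ≤ ((1 + ‖x‖ ^ 2) ^ 2)⁻¹),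
    mul_left_comm]
  exact mul_le_mul_of_nonneg_left (hC x) (by positivity)

theorem exists_isGivenBy_of_le {f : E3 → ℝ} (hm : Measurable f) {C : ℝ}
    (hC : ∀ x, |f x| ≤ C * (1 + (‖x‖ ^ 2)⁻¹)) : ∃ T, IsGivenBy T f :=
  exists_isGivenBy_of_integrable 2 (integrable_weighted_of_le hm hC)

/-! ### Coordinates and derivatives under the Fourier transform -/

theorem hasTemperateGrowth_coord (i : Fin 3) : (fun x : E3 => x i).HasTemperateGrowth :=
  (EuclideanSpace.proj i : E3 →L[ℝ] ℝ).hasTemperateGrowth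

/-- Multiplication of Schwartz functions by the `i`-th coordinate. -/
noncomputable def mulCoord (i : Fin 3) : 𝓢(E3, ℂ) →L[ℝ] 𝓢(E3, ℂ) :=
  smulLeftCLM ℂ (fun x : E3 => x i)

@[simp]
theorem mulCoord_apply (i : Fin 3) (φ : 𝓢(E3, ℂ)) (x : E3) : mulCoord i φ x = x i * φ x := by
  simp [mulCoord, smulLeftCLM_apply_apply (hasTemperateGrowth_coord i)]

theorem inner_e (i : Fin 3) : (inner ℝ · (e i) : E3 → ℝ) = fun x => x i := by
  funext x; simp [e, EuclideanSpace.inner_single_right]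

theorem lineDeriv_fourier (φ : 𝓢(E3, ℂ)) (i : Fin 3) :
    ∂_{e i} (𝓕 φ) = 𝓕 (-(2 * Real.pi * Complex.I) • mulCoord i φ) := by
  rw [lineDerivOp_fourier_eq, inner_e, mulCoord]

theorem fourier_lineDeriv (φ : 𝓢(E3, ℂ)) (i : Fin 3) :
    𝓕 (∂_{e i} φ) = (2 * Real.pi * Complex.I) • mulCoord i (𝓕 φ) := by
  rw [fourier_lineDerivOp_eq, inner_e, mulCoord]

/-! ### Gaussians and the quartic Hermite identity -/

/-- The Gaussian `exp (-π u |x|²)`. -/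
noncomputable def gauss (u : ℝ) (x : E3) : ℝ := Real.exp (-(Real.pi * u * ‖x‖ ^ 2))

theorem continuous_gauss (u : ℝ) : Continuous (gauss u) := by unfold gauss; fun_prop

theorem integrable_schwartz_mul_gauss {u : ℝ} (hu : 0 < u) {p : E3 → ℝ}
    (hp : p.HasTemperateGrowth) (φ : 𝓢(E3, ℂ)) :
    Integrable fun x => φ x * ((p x * gauss u x : ℝ) : ℂ) := by
  have h := (smulLeftCLM ℂ p φ).integrable (μ := volume)
  refine (h.bdd_mul (c := 1) (f := fun x => (gauss u x : ℂ))
    (Complex.continuous_ofReal.comp (continuous_gauss u)).aestronglyMeasurable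
    (.of_forall fun x => ?_)).congr (.of_forall fun x => ?_)
  · rw [Complex.norm_real, gauss, Real.norm_of_nonneg (Real.exp_pos _).le]
    exact Real.exp_le_one_iff.mpr (by have := Real.pi_pos; rw [neg_nonpos]; positivity)
  · simp only [smulLeftCLM_apply_apply hp, Complex.real_smul]
    push_cast; ring

theorem hasLineDerivAt_gauss (u : ℝ) (x : E3) (i : Fin 3) :
    HasLineDerivAt ℝ (gauss u) (-(2 * Real.pi * u * x i) * gauss u x) x (e i) := by
  have h : HasFDerivAt (fun x : E3 => ‖x‖ ^ 2) _ x := (hasStrictFDerivAt_norm_sq x).hasFDerivAt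
  have h2 := ((h.const_mul (Real.pi * u)).neg.exp).hasLineDerivAt (e i)
  convert! h2 using 1
  simp [gauss, e, EuclideanSpace.inner_single_right]
  ring

/-- Integration by parts acts on the polynomial factor as the Hermite raising operator `p ↦ 2πu xᵢ p
- ∂ᵢ p`, so it can be iterated. -/
theorem integral_lineDeriv_mul_gauss {u : ℝ} (hu : 0 < u) {p p' : E3 → ℝ} (i : Fin 3)
    (hp : p.HasTemperateGrowth) (hp' : p'.HasTemperateGrowth)
    (h : ∀ x, HasLineDerivAt ℝ p (p' x) x (e i)) (φ : 𝓢(E3, ℂ)) :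
    ∫ x, (∂_{e i} φ) x * ((p x * gauss u x : ℝ) : ℂ) =
      ∫ x, φ x * (((2 * Real.pi * u * x i * p x - p' x) * gauss u x : ℝ) : ℂ) := by
  have hg : ∀ x, HasLineDerivAt ℝ (fun x => ((p x * gauss u x : ℝ) : ℂ))
      (((p' x - 2 * Real.pi * u * x i * p x) * gauss u x : ℝ) : ℂ) x (e i) := by
    intro x
    have h1 : HasDerivAt _ _ _ := h x
    have h2 : HasDerivAt _ _ _ := hasLineDerivAt_gauss u x i
    have h3 := (h1.mul h2).ofReal_comp
    change HasDerivAt _ _ _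
    convert! h3 using 1
    simp
    ring
  have hf : ∀ x, HasLineDerivAt ℝ φ ((∂_{e i} φ) x) x (e i) := by
    intro x
    rw [SchwartzMap.lineDerivOp_apply_eq_fderiv]
    exact (φ.differentiable x).hasFDerivAt.hasLineDerivAt _
  have hc := hasTemperateGrowth_coord i
  have := integral_bilinear_hasLineDerivAt_right_eq_neg_left_of_integrable (μ := volume)
    (B := ContinuousLinearMap.mul ℝ ℂ)
    (integrable_schwartz_mul_gauss hu hp (∂_{e i} φ))
    (integrable_schwartz_mul_gauss hu (p := fun x => p' x - 2 * Real.pi * u * x i * p x)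
      (by fun_prop) φ)
    (integrable_schwartz_mul_gauss hu hp φ) (fun x _ => hf x) (fun x _ => hg x)
  simp only [ContinuousLinearMap.mul_apply'] at this
  rw [← neg_eq_iff_eq_neg] at this
  rw [← this, ← integral_neg]
  refine integral_congr_ae (.of_forall fun x => ?_)
  simp only
  push_cast; ring

theorem fourier_gauss {u : ℝ} (hu : 0 < u) (η : E3) :
    𝓕 (fun x : E3 => (gauss u x : ℂ)) η =
      ((u ^ (-(3 / 2) : ℝ) * Real.exp (-(Real.pi * ‖η‖ ^ 2 / u)) : ℝ) : ℂ) := by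
  have h := fourier_gaussian_innerProductSpace (V := E3) (b := ((Real.pi * u : ℝ) : ℂ))
    (by rw [Complex.ofReal_re]; have := Real.pi_pos; positivity) η
  have e1 : (fun x : E3 => (gauss u x : ℂ)) =
      fun v : E3 => Complex.exp (-((Real.pi * u : ℝ) : ℂ) * (‖v‖ : ℂ) ^ 2) := by
    funext x; simp [gauss]
  have hpi : (Real.pi : ℂ) ≠ 0 := Complex.ofReal_ne_zero.mpr Real.pi_ne_zero
  have huc : (u : ℂ) ≠ 0 := Complex.ofReal_ne_zero.mpr hu.ne'
  rw [e1, h, Complex.ofReal_mul (u ^ _), Complex.ofReal_exp]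
  congr 1
  · have : (Real.pi : ℂ) / ((Real.pi * u : ℝ) : ℂ) = ((u⁻¹ : ℝ) : ℂ) := by
      push_cast; field_simp
    rw [this, finrank_euclideanSpace]
    have h3 : ((Fintype.card (Fin 3) : ℂ) / 2) = ((3 / 2 : ℝ) : ℂ) := by simp
    rw [h3, ← Complex.ofReal_cpow (inv_nonneg.mpr hu.le),
      Real.inv_rpow hu.le, Real.rpow_neg hu.le]
  · congr 1
    push_cast; field_simp

theorem integral_fourier_mul_gauss {u : ℝ} (hu : 0 < u) (φ : 𝓢(E3, ℂ)) :
    ∫ x, 𝓕 φ x * (gauss u x : ℂ) = ∫ η, φ η *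
      ((u ^ (-(3 / 2) : ℝ) * Real.exp (-(Real.pi * ‖η‖ ^ 2 / u)) : ℝ) : ℂ) := by
  have hint : Integrable (fun x : E3 => (gauss u x : ℂ)) := by
    have h := GaussianFourier.integrable_cexp_neg_mul_sq_norm_add (V := E3)
      (b := ((Real.pi * u : ℝ) : ℂ))
      (by rw [Complex.ofReal_re]; have := Real.pi_pos; positivity) 0 0
    refine h.congr (.of_forall fun x => ?_)
    simp [gauss]
  have := VectorFourier.integral_bilin_fourierIntegral_eq_flip (ContinuousLinearMap.mul ℂ ℂ)
    (L := innerₗ E3) Real.continuous_fourierChar continuous_inner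
    (φ.integrable (μ := volume)) hint
  simp only [ContinuousLinearMap.mul_apply', flip_innerₗ] at this
  refine this.trans (integral_congr_ae (.of_forall fun η => ?_))
  simp only
  rw [← fourier_gauss hu η]
  rfl

/-- The Kronecker delta. -/
def kd (i j : Fin 3) : ℝ := if i = j then 1 else 0

theorem hasLineDerivAt_coord (i j : Fin 3) (x : E3) :
    HasLineDerivAt ℝ (fun x : E3 => x i) (kd i j) x (e j) := by
  have := ((EuclideanSpace.proj i : E3 →L[ℝ] ℝ).hasFDerivAt (x := x)).hasLineDerivAt (e j)
  convert! this using 1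
  simp [kd, e, PiLp.single_apply]

/-- The sum of the six terms `δ x x`. -/
noncomputable def sumSix (i j k l : Fin 3) (x : E3) : ℝ :=
  kd i j * x k * x l + kd i k * x j * x l + kd i l * x j * x k
    + kd j k * x i * x l + kd j l * x i * x k + kd k l * x i * x j

/-- The sum of the three terms `δ δ`. -/
def sumThree (i j k l : Fin 3) : ℝ :=
  kd i j * kd k l + kd i k * kd j l + kd i l * kd j k

theorem integral_fourier_mul_hermite_gauss {u : ℝ} (hu : 0 < u) (φ : 𝓢(E3, ℂ))
    (i j k l : Fin 3) :
    ∫ x, 𝓕 φ x * ((((2 * Real.pi * u) ^ 4 * (x i * x j * x k * x l)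
        - (2 * Real.pi * u) ^ 3 * sumSix i j k l x + (2 * Real.pi * u) ^ 2 * sumThree i j k l)
          * gauss u x : ℝ) : ℂ) =
      ∫ η, φ η * (((2 * Real.pi) ^ 4 * (η i * η j * η k * η l) *
        (u ^ (-(3 / 2) : ℝ) * Real.exp (-(Real.pi * ‖η‖ ^ 2 / u))) : ℝ) : ℂ) := by
  have ci := hasTemperateGrowth_coord i
  have cj := hasTemperateGrowth_coord j
  have ck := hasTemperateGrowth_coord k
  have cl := hasTemperateGrowth_coord l
  set c : ℝ := 2 * Real.pi * u with hc
  have d : ∀ (m n : Fin 3) (x : E3),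
      HasDerivAt (fun t : ℝ => (x + t • e n) m) (kd m n) 0 := fun m n x => hasLineDerivAt_coord m n x
  have s1 := integral_lineDeriv_mul_gauss hu (p := fun _ => 1) (p' := fun _ => 0) l
    (by fun_prop) (by fun_prop) (fun x => hasDerivAt_const _ _) (∂_{e k} (∂_{e j} (∂_{e i} (𝓕 φ))))
  -- Each `p` keeps the unsimplified shape produced by the preceding integration by parts, so that
  -- the four equalities chain by transitivity.
  have s2 := integral_lineDeriv_mul_gauss hu (p := fun x => c * x l * 1 - 0)
    (p' := fun _ => c * kd l k) k (by fun_prop) (by fun_prop)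
    (fun x => by
      have := (d l k x).const_mul c
      change HasDerivAt _ _ _
      convert! this using 1
      funext t; simp) (∂_{e j} (∂_{e i} (𝓕 φ)))
  have s3 := integral_lineDeriv_mul_gauss hu
    (p := fun x => c * x k * (c * x l * 1 - 0) - c * kd l k)
    (p' := fun x => c ^ 2 * (kd k j * x l + x k * kd l j)) j (by fun_prop) (by fun_prop)
    (fun x => by
      have := (((d k j x).mul (d l j x)).const_mul (c ^ 2)).sub_const (c * kd l k)
      change HasDerivAt _ _ _
      convert! this using 1
      · funext t; simp; ring
      · simp) (∂_{e i} (𝓕 φ))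
  have s4 := integral_lineDeriv_mul_gauss hu
    (p := fun x => c * x j * (c * x k * (c * x l * 1 - 0) - c * kd l k)
      - c ^ 2 * (kd k j * x l + x k * kd l j))
    (p' := fun x => c ^ 3 * (kd j i * x k * x l + x j * kd k i * x l + x j * x k * kd l i)
      - c ^ 2 * (kd j i * kd l k + kd k j * kd l i + kd k i * kd l j)) i
    (by fun_prop) (by fun_prop)
    (fun x => by
      have := (((((d j i x).mul (d k i x)).mul (d l i x)).const_mul (c ^ 3)).sub
        ((d j i x).const_mul (c ^ 2 * kd l k))).sub
          ((((d l i x).const_mul (kd k j)).add ((d k i x).mul_const (kd l j))).const_mul (c ^ 2))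
      change HasDerivAt _ _ _
      convert! this using 1
      · funext t; simp; ring
      · simp; ring) (𝓕 φ)
  have hs := (s1.trans s2).trans (s3.trans s4)
  -- Four derivatives contribute `(-2πi)⁴ = (2π)⁴`, which is real.
  have hF : ∂_{e l} (∂_{e k} (∂_{e j} (∂_{e i} (𝓕 φ)))) = 𝓕 (((2 * Real.pi : ℝ) : ℂ) ^ 4 •
      mulCoord l (mulCoord k (mulCoord j (mulCoord i φ)))) := by
    simp only [lineDeriv_fourier]
    congr 1
    ext x
    simp only [smul_apply, mulCoord_apply, smul_eq_mul]
    have : Complex.I ^ 4 = 1 := Complex.I_pow_four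
    push_cast
    linear_combination (2 * Real.pi : ℂ) ^ 4 * (x i * x j * x k * x l * φ x) * this
  have hG := integral_fourier_mul_gauss hu
    (((2 * Real.pi : ℝ) : ℂ) ^ 4 • mulCoord l (mulCoord k (mulCoord j (mulCoord i φ))))
  simp only [← hF, smul_apply, mulCoord_apply, smul_eq_mul] at hG
  simp only [one_mul] at hs
  rw [hs] at hG
  have kc : ∀ m n, kd m n = kd n m := fun m n => by simp [kd, eq_comm]
  refine Eq.trans (integral_congr_ae (.of_forall fun x => ?_))
    (hG.trans (integral_congr_ae (.of_forall fun x => ?_)))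
  · simp only [sumSix, sumThree]
    rw [kc l k, kc k j, kc l j, kc j i, kc k i, kc l i, hc]
    congr 2
    ring
  · push_cast
    ring

theorem integral_sub_add {α : Type*} [MeasurableSpace α] {μ : Measure α} {f g h : α → ℂ}
    (hf : Integrable f μ) (hg : Integrable g μ) (hh : Integrable h μ) :
    ∫ x, f x - g x + h x ∂μ = ∫ x, f x ∂μ - ∫ x, g x ∂μ + ∫ x, h x ∂μ := by
  rw [← integral_sub hf hg]
  exact integral_add (hf.sub hg) hh

/-! ### Integration over the Gaussian width -/

/-- Fubini's theorem for a nonnegative kernel whose second marginal is known. -/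
theorem integral_integral_kernel {F : E3 → ℂ} {κ : E3 → ℝ → ℝ} {m : E3 → ℝ}
    (hF : AEStronglyMeasurable F) (hκ : Measurable (Function.uncurry κ))
    (h0 : ∀ x, ∀ u > 0, 0 ≤ κ x u) (hm : ∀ x ≠ 0, ∫ u in Set.Ioi 0, κ x u = m x)
    (hm0 : ∀ x ≠ 0, m x ≠ 0) (hi : Integrable fun x => F x * (m x : ℂ)) :
    IntegrableOn (fun u => ∫ x, F x * (κ x u : ℂ)) (Set.Ioi 0) ∧
      ∫ u in Set.Ioi 0, ∫ x, F x * (κ x u : ℂ) = ∫ x, F x * (m x : ℂ) := by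
  have hne : ∀ᵐ x : E3, x ≠ 0 := by
    simp [ae_iff, measure_singleton]
  have hint : Integrable (Function.uncurry fun (x : E3) (u : ℝ) => F x * (κ x u : ℂ))
      (volume.prod (volume.restrict (Set.Ioi 0))) := by
    refine (integrable_prod_iff ?_).mpr ⟨?_, ?_⟩
    · exact (hF.comp_fst (μ := volume)).mul (Complex.measurable_ofReal.comp hκ).aestronglyMeasurable
    · filter_upwards [hne] with x hx
      -- A non-integrable function has Bochner integral `0`, so the nonzero value `m x` already
      -- forces integrability.
      have h1 : IntegrableOn (κ x) (Set.Ioi 0) :=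
        Integrable.of_integral_ne_zero (by rw [hm x hx]; exact hm0 x hx)
      exact h1.ofReal.const_mul (F x)
    · refine hi.norm.congr ?_
      filter_upwards [hne] with x hx
      have h1 : ∀ u ∈ Set.Ioi (0 : ℝ), ‖F x * (κ x u : ℂ)‖ = ‖F x‖ * κ x u := fun u hu => by
        rw [norm_mul, Complex.norm_real, Real.norm_of_nonneg (h0 x u hu)]
      have hpos : 0 ≤ m x := by
        rw [← hm x hx]
        exact setIntegral_nonneg measurableSet_Ioi fun u hu => h0 x u hu
      simp only [Function.uncurry_apply_pair]
      rw [setIntegral_congr_fun measurableSet_Ioi h1, integral_const_mul, hm x hx, norm_mul,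
        Complex.norm_real, Real.norm_of_nonneg hpos]
  refine ⟨hint.integral_prod_right, ?_⟩
  rw [← integral_integral_swap hint]
  refine integral_congr_ae ?_
  filter_upwards [hne] with x hx
  rw [integral_const_mul, integral_complex_ofReal, hm x hx]

theorem integral_rpow_mul_exp_mul_norm_sq {s : ℝ} (hs : 0 < s) {x : E3} (hx : x ≠ 0) :
    ∫ u in Set.Ioi (0 : ℝ), u ^ (s - 1) * Real.exp (-(Real.pi * ‖x‖ ^ 2 * u)) =
      (1 / (Real.pi * ‖x‖ ^ 2)) ^ s * Real.Gamma s :=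
  Real.integral_rpow_mul_exp_neg_mul_Ioi hs
    (mul_pos Real.pi_pos (pow_pos (norm_pos_iff.mpr hx) 2))

theorem integral_rpow_half {x : E3} (hx : x ≠ 0) :
    ∫ u in Set.Ioi (0 : ℝ), u ^ (-(1 / 2) : ℝ) * Real.exp (-(Real.pi * ‖x‖ ^ 2 * u)) =
      1 / ‖x‖ ^ 1 := by
  have h := integral_rpow_mul_exp_mul_norm_sq (s := 1 / 2) (by norm_num) hx
  have hr := norm_pos_iff.mpr hx
  have hpi := Real.pi_pos
  rw [show (1 / 2 - 1 : ℝ) = -(1 / 2) by norm_num] at h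
  rw [h, ← Real.sqrt_eq_rpow, Real.Gamma_one_half_eq, Real.sqrt_div (by norm_num),
    Real.sqrt_mul hpi.le, Real.sqrt_sq hr.le]
  have := Real.sqrt_pos.mpr hpi
  rw [Real.sqrt_one]
  field_simp

theorem integral_rpow_three_half {x : E3} (hx : x ≠ 0) :
    ∫ u in Set.Ioi (0 : ℝ), u ^ (1 / 2 : ℝ) * Real.exp (-(Real.pi * ‖x‖ ^ 2 * u)) =
      1 / (2 * Real.pi) / ‖x‖ ^ 3 := by
  have h := integral_rpow_mul_exp_mul_norm_sq (s := 1 / 2 + 1) (by norm_num) hx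
  have hr := norm_pos_iff.mpr hx
  have hpi := Real.pi_pos
  rw [add_sub_cancel_right] at h
  rw [h, Real.rpow_add_one (by positivity), ← Real.sqrt_eq_rpow, Real.Gamma_add_one (by norm_num),
    Real.Gamma_one_half_eq, Real.sqrt_div (by norm_num), Real.sqrt_mul hpi.le,
    Real.sqrt_sq hr.le]
  have := Real.sqrt_pos.mpr hpi
  rw [Real.sqrt_one]
  field_simp

theorem integral_rpow_five_half {x : E3} (hx : x ≠ 0) :
    ∫ u in Set.Ioi (0 : ℝ), u ^ (3 / 2 : ℝ) * Real.exp (-(Real.pi * ‖x‖ ^ 2 * u)) =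
      3 / (4 * Real.pi ^ 2) / ‖x‖ ^ 5 := by
  have h := integral_rpow_mul_exp_mul_norm_sq (s := 1 / 2 + 1 + 1) (by norm_num) hx
  have hr := norm_pos_iff.mpr hx
  have hpi := Real.pi_pos
  rw [show (1 / 2 + 1 + 1 - 1 : ℝ) = 3 / 2 by norm_num] at h
  rw [h, Real.rpow_add_one (by positivity), Real.rpow_add_one (by positivity),
    ← Real.sqrt_eq_rpow, Real.Gamma_add_one (by norm_num), Real.Gamma_add_one (by norm_num),
    Real.Gamma_one_half_eq, Real.sqrt_div (by norm_num), Real.sqrt_mul hpi.le,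
    Real.sqrt_sq hr.le]
  have := Real.sqrt_pos.mpr hpi
  rw [Real.sqrt_one]
  field_simp
  norm_num

theorem integral_rpow_neg_four {x : E3} (hx : x ≠ 0) :
    ∫ u in Set.Ioi (0 : ℝ), u ^ (-4 : ℝ) * Real.exp (-(Real.pi * ‖x‖ ^ 2 / u)) =
      2 / Real.pi ^ 3 / ‖x‖ ^ 6 := by
  have h := integral_rpow_mul_exp_mul_norm_sq (s := 3) (by norm_num) hx
  have hr := norm_pos_iff.mpr hx
  -- Substituting `u ↦ u⁻¹` brings the Gamma integral with `s = 3` to the form in which the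
  -- transformed Gaussian appears.
  rw [← integral_comp_rpow_Ioi _ (show (-1 : ℝ) ≠ 0 by norm_num)] at h
  have hG : Real.Gamma 3 = 2 := by
    have := Real.Gamma_nat_eq_factorial 2
    rw [show ((2 : ℕ) : ℝ) + 1 = 3 by norm_num] at this
    rw [this]; norm_num [Nat.factorial]
  rw [hG, show (3 : ℝ) = ((3 : ℕ) : ℝ) by norm_num, Real.rpow_natCast] at h
  have e1 : (1 / (Real.pi * ‖x‖ ^ 2)) ^ 3 * 2 = 2 / Real.pi ^ 3 / ‖x‖ ^ 6 := by
    field_simp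
  rw [← e1, ← h]
  refine setIntegral_congr_fun measurableSet_Ioi fun u hu => ?_
  have hu : (0 : ℝ) < u := hu
  simp only [smul_eq_mul, abs_neg, abs_one, one_mul]
  rw [← Real.rpow_mul hu.le, ← mul_assoc, ← Real.rpow_add hu, Real.rpow_neg_one, ← div_eq_mul_inv]
  norm_num

/-! ### Bounds for quotients of degree `-1` and `-2` -/

theorem abs_mul_div_norm_pow_le {h : E3 → ℝ} {A : ℝ} {d a : ℕ} (ha : a = 1 ∨ a = 2)
    (hh : ∀ x, |h x| ≤ A * ‖x‖ ^ d) (c : ℝ) (x : E3) :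
    |h x * (c / ‖x‖ ^ (d + a))| ≤ A * |c| * (1 + (‖x‖ ^ 2)⁻¹) := by
  have hA : 0 ≤ A := by
    have := (abs_nonneg _).trans (hh (e 0))
    simpa [e] using this
  rcases eq_or_ne x 0 with rfl | hx
  · have : (0 : ℝ) ^ (d + a) = 0 := zero_pow (by omega)
    simp [this]; positivity
  have hr := norm_pos_iff.mpr hx
  rw [abs_mul, abs_div, abs_of_pos (pow_pos hr (d + a))]
  calc |h x| * (|c| / ‖x‖ ^ (d + a)) ≤ A * ‖x‖ ^ d * (|c| / ‖x‖ ^ (d + a)) := by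
        gcongr; exact hh x
    _ = A * |c| * (‖x‖ ^ a)⁻¹ := by rw [pow_add]; field_simp
    _ ≤ A * |c| * (1 + (‖x‖ ^ 2)⁻¹) := by
        gcongr
        rcases ha with rfl | rfl
        · have : (‖x‖ ^ 2)⁻¹ = (‖x‖ ^ 1)⁻¹ ^ 2 := by simp
          rw [this]
          nlinarith [sq_nonneg ((‖x‖ ^ 1)⁻¹ - 1)]
        · linarith

theorem integrable_schwartz_mul_div {h : E3 → ℝ} {A : ℝ} {d a : ℕ} (ha : a = 1 ∨ a = 2)
    (hh : ∀ x, |h x| ≤ A * ‖x‖ ^ d) (hm : Measurable h) (c : ℝ) (φ : 𝓢(E3, ℂ)) :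
    Integrable fun x => φ x * (h x : ℂ) * ((c / ‖x‖ ^ (d + a) : ℝ) : ℂ) := by
  obtain ⟨T, hT⟩ := exists_isGivenBy_of_le (f := fun x => h x * (c / ‖x‖ ^ (d + a)))
    (by fun_prop) (abs_mul_div_norm_pow_le ha hh c)
  refine (hT φ).1.congr (.of_forall fun x => ?_)
  simp only
  push_cast; ring

theorem abs_coord_le (x : E3) (i : Fin 3) : |x i| ≤ ‖x‖ := by
  simpa using PiLp.norm_apply_le x i

theorem abs_kd_le (i j : Fin 3) : |kd i j| ≤ 1 := by
  unfold kd; split_ifs <;> simp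

theorem abs_quartic_le (i j k l : Fin 3) (x : E3) : |x i * x j * x k * x l| ≤ 1 * ‖x‖ ^ 4 := by
  have h := abs_coord_le x
  rw [abs_mul, abs_mul, abs_mul]
  calc |x i| * |x j| * |x k| * |x l| ≤ ‖x‖ * ‖x‖ * ‖x‖ * ‖x‖ := by gcongr <;> exact h _
    _ = 1 * ‖x‖ ^ 4 := by ring

theorem abs_sumSix_le (i j k l : Fin 3) (x : E3) : |sumSix i j k l x| ≤ 6 * ‖x‖ ^ 2 := by
  have key : ∀ a b c d : Fin 3, |kd a b * x c * x d| ≤ ‖x‖ ^ 2 := by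
    intro a b c d
    rw [abs_mul, abs_mul]
    calc |kd a b| * |x c| * |x d| ≤ 1 * ‖x‖ * ‖x‖ := by
          gcongr
          · exact abs_kd_le _ _
          · exact abs_coord_le x _
          · exact abs_coord_le x _
      _ = ‖x‖ ^ 2 := by ring
  unfold sumSix
  have h1 := abs_le.mp (key i j k l)
  have h2 := abs_le.mp (key i k j l)
  have h3 := abs_le.mp (key i l j k)
  have h4 := abs_le.mp (key j k i l)
  have h5 := abs_le.mp (key j l i k)
  have h6 := abs_le.mp (key k l i j)
  rw [abs_le]
  constructor <;> linarith

theorem measurable_sumSix (i j k l : Fin 3) : Measurable (sumSix i j k l) := by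
  unfold sumSix; fun_prop

/-! ### The Fourier transform of the quartic tensor over `|ξ|⁶` -/

/-- The inverse Fourier transform of `ξᵢ ξⱼ ξₖ ξₗ / |ξ|⁶`. -/
noncomputable def kern (i j k l : Fin 3) (x : E3) : ℝ :=
  (3 * (x i * x j * x k * x l) - ‖x‖ ^ 2 * sumSix i j k l x + ‖x‖ ^ 4 * sumThree i j k l) /
    (32 * Real.pi * ‖x‖ ^ 5)

theorem integral_fourier_mul_kern (φ : 𝓢(E3, ℂ)) (i j k l : Fin 3) :
    ∫ x, 𝓕 φ x * (kern i j k l x : ℂ) = ∫ η, φ η *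
      ((((2 * Real.pi) • η) i * ((2 * Real.pi) • η) j * ((2 * Real.pi) • η) k *
        ((2 * Real.pi) • η) l / ‖(2 * Real.pi) • η‖ ^ 6 : ℝ) : ℂ) := by
  have hpi := Real.pi_pos
  have hq : Measurable fun x : E3 => x i * x j * x k * x l := by fun_prop
  have hm6 := measurable_sumSix i j k l
  have meas : ∀ (ψ : 𝓢(E3, ℂ)) {h : E3 → ℝ}, Measurable h →
      AEStronglyMeasurable (fun x => ψ x * (h x : ℂ)) := fun ψ h hh =>
    (ψ.continuous.measurable.mul (Complex.measurable_ofReal.comp hh)).aestronglyMeasurable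
  have A1 := integral_integral_kernel
    (F := fun x => 𝓕 φ x * ((x i * x j * x k * x l : ℝ) : ℂ))
    (κ := fun x u => u ^ (3 / 2 : ℝ) * Real.exp (-(Real.pi * ‖x‖ ^ 2 * u)))
    (m := fun x => 3 / (4 * Real.pi ^ 2) / ‖x‖ ^ 5) (meas _ hq)
    (by unfold Function.uncurry; fun_prop)
    (fun x u hu => by have : 0 < u := hu; positivity)
    (fun x hx => integral_rpow_five_half hx)
    (fun x hx => by have := norm_pos_iff.mpr hx; positivity)
    (integrable_schwartz_mul_div (d := 4) (a := 1) (.inl rfl) (abs_quartic_le i j k l) hq _ _)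
  have A2 := integral_integral_kernel
    (F := fun x => 𝓕 φ x * ((sumSix i j k l x : ℝ) : ℂ))
    (κ := fun x u => u ^ (1 / 2 : ℝ) * Real.exp (-(Real.pi * ‖x‖ ^ 2 * u)))
    (m := fun x => 1 / (2 * Real.pi) / ‖x‖ ^ 3) (meas _ hm6)
    (by unfold Function.uncurry; fun_prop)
    (fun x u hu => by have : 0 < u := hu; positivity)
    (fun x hx => integral_rpow_three_half hx)
    (fun x hx => by have := norm_pos_iff.mpr hx; positivity)
    (integrable_schwartz_mul_div (d := 2) (a := 1) (.inl rfl) (abs_sumSix_le i j k l) hm6 _ _)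
  have A3 := integral_integral_kernel
    (F := fun x => 𝓕 φ x * ((sumThree i j k l : ℝ) : ℂ))
    (κ := fun x u => u ^ (-(1 / 2) : ℝ) * Real.exp (-(Real.pi * ‖x‖ ^ 2 * u)))
    (m := fun x => 1 / ‖x‖ ^ 1) (meas _ measurable_const)
    (by unfold Function.uncurry; fun_prop)
    (fun x u hu => by have : 0 < u := hu; positivity)
    (fun x hx => integral_rpow_half hx)
    (fun x hx => by have := norm_pos_iff.mpr hx; positivity)
    (integrable_schwartz_mul_div (d := 0) (a := 1) (.inl rfl)
      (A := |sumThree i j k l|) (fun x => by simp) measurable_const _ _)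
  have A4 := integral_integral_kernel
    (F := fun x => φ x * ((x i * x j * x k * x l : ℝ) : ℂ))
    (κ := fun x u => u ^ (-4 : ℝ) * Real.exp (-(Real.pi * ‖x‖ ^ 2 / u)))
    (m := fun x => 2 / Real.pi ^ 3 / ‖x‖ ^ 6) (meas _ hq)
    (by unfold Function.uncurry; fun_prop)
    (fun x u hu => by have : 0 < u := hu; positivity)
    (fun x hx => integral_rpow_neg_four hx)
    (fun x hx => by have := norm_pos_iff.mpr hx; positivity)
    (integrable_schwartz_mul_div (d := 4) (a := 2) (.inr rfl) (abs_quartic_le i j k l) hq _ _)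
  have ci := hasTemperateGrowth_coord i
  have cj := hasTemperateGrowth_coord j
  have ck := hasTemperateGrowth_coord k
  have cl := hasTemperateGrowth_coord l
  set P : ℂ := 2 * Real.pi with hP
  have point : ∀ u ∈ Set.Ioi (0 : ℝ),
      P ^ 4 * (∫ x, 𝓕 φ x * ((x i * x j * x k * x l : ℝ) : ℂ) *
          ((u ^ (3 / 2 : ℝ) * Real.exp (-(Real.pi * ‖x‖ ^ 2 * u)) : ℝ) : ℂ)) -
        P ^ 3 * (∫ x, 𝓕 φ x * ((sumSix i j k l x : ℝ) : ℂ) *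
          ((u ^ (1 / 2 : ℝ) * Real.exp (-(Real.pi * ‖x‖ ^ 2 * u)) : ℝ) : ℂ)) +
        P ^ 2 * (∫ x, 𝓕 φ x * ((sumThree i j k l : ℝ) : ℂ) *
          ((u ^ (-(1 / 2) : ℝ) * Real.exp (-(Real.pi * ‖x‖ ^ 2 * u)) : ℝ) : ℂ)) =
        P ^ 4 * ∫ x, φ x * ((x i * x j * x k * x l : ℝ) : ℂ) *
          ((u ^ (-4 : ℝ) * Real.exp (-(Real.pi * ‖x‖ ^ 2 / u)) : ℝ) : ℂ) := by
    intro u hu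
    have hu : 0 < u := hu
    -- The weight `u ^ (-5/2)` is dictated by the target: with the factor `u ^ (-3/2)` of the
    -- transformed Gaussian it gives `u ^ (-4)`, whose integral is proportional to `|η|⁻⁶`. On the
    -- other side the powers `u⁴, u³, u²` become `u ^ (3/2), u ^ (1/2), u ^ (-1/2)`, hence `|x|⁻⁵,
    -- |x|⁻³, |x|⁻¹`.
    have h := congrArg (fun z => ((u ^ (-(5 / 2) : ℝ) : ℝ) : ℂ) * z)
      (integral_fourier_mul_hermite_gauss hu φ i j k l)
    simp only [← integral_const_mul] at h ⊢
    have e1 : u ^ (3 / 2 : ℝ) = u ^ (-(5 / 2) : ℝ) * u ^ 4 := by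
      rw [← Real.rpow_natCast, ← Real.rpow_add hu]; norm_num
    have e2 : u ^ (1 / 2 : ℝ) = u ^ (-(5 / 2) : ℝ) * u ^ 3 := by
      rw [← Real.rpow_natCast, ← Real.rpow_add hu]; norm_num
    have e3 : u ^ (-(1 / 2) : ℝ) = u ^ (-(5 / 2) : ℝ) * u ^ 2 := by
      rw [← Real.rpow_natCast, ← Real.rpow_add hu]; norm_num
    have e4 : u ^ (-4 : ℝ) = u ^ (-(5 / 2) : ℝ) * u ^ (-(3 / 2) : ℝ) := by
      rw [← Real.rpow_add hu]; norm_num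
    have ee : ∀ x : E3, Real.exp (-(Real.pi * ‖x‖ ^ 2 * u)) = gauss u x := fun x => by
      rw [gauss]; congr 1; ring
    have I : ∀ {p : E3 → ℝ} (c : ℝ) (q : ℂ), p.HasTemperateGrowth →
        Integrable fun x => q * (𝓕 φ x * ((p x : ℝ) : ℂ) * ((c * gauss u x : ℝ) : ℂ)) := by
      intro p c q hp
      refine ((integrable_schwartz_mul_gauss hu hp (𝓕 φ)).const_mul (q * c)).congr
        (.of_forall fun x => ?_)
      simp only; push_cast; ring
    simp only [ee]
    have h6 : (sumSix i j k l).HasTemperateGrowth := by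
      unfold sumSix; fun_prop
    rw [← integral_sub_add (I (p := fun x => x i * x j * x k * x l) _ _ (by fun_prop)) (I _ _ h6)
      (I (p := fun _ => sumThree i j k l) _ _ (by fun_prop))]
    refine Eq.trans (integral_congr_ae (.of_forall fun x => ?_))
      (h.trans (integral_congr_ae (.of_forall fun x => ?_)))
    · simp only [e1, e2, e3, hP]
      push_cast; ring
    · simp only [e4, hP]
      push_cast; ring
  have tot := setIntegral_congr_fun (μ := volume) measurableSet_Ioi point
  rw [integral_sub_add (A1.1.const_mul _) (A2.1.const_mul _) (A3.1.const_mul _)] at tot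
  simp only [integral_const_mul] at tot
  rw [A1.2, A2.2, A3.2, A4.2] at tot
  simp only [← integral_const_mul] at tot
  have B1 := (integrable_schwartz_mul_div (d := 4) (a := 1) (.inl rfl) (abs_quartic_le i j k l) hq
    (3 / (4 * Real.pi ^ 2)) (𝓕 φ)).const_mul (P ^ 4)
  have B2 := (integrable_schwartz_mul_div (d := 2) (a := 1) (.inl rfl) (abs_sumSix_le i j k l) hm6
    (1 / (2 * Real.pi)) (𝓕 φ)).const_mul (P ^ 3)
  have B3 := (integrable_schwartz_mul_div (d := 0) (a := 1) (.inl rfl)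
      (A := |sumThree i j k l|) (h := fun _ => sumThree i j k l) (fun x => by simp)
      measurable_const 1 (𝓕 φ)).const_mul (P ^ 2)
  rw [← integral_sub_add B1 B2 B3] at tot
  -- The integrated identity is `128π³` times the desired one: for the leading term, `(2π)⁴ ·
  -- 3/(4π²) = 128π³ · 3/(32π)`.
  have hc : (128 * (Real.pi : ℂ) ^ 3) ≠ 0 := by
    have := Complex.ofReal_ne_zero.mpr Real.pi_ne_zero
    simp
  refine mul_left_cancel₀ hc ?_
  rw [← integral_const_mul, ← integral_const_mul]
  have hne : ∀ᵐ x : E3, x ≠ 0 := by simp [ae_iff, measure_singleton]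
  refine Eq.trans (integral_congr_ae ?_) (tot.trans (integral_congr_ae ?_))
  · filter_upwards [hne] with x hx
    have hr : (‖x‖ : ℂ) ≠ 0 := Complex.ofReal_ne_zero.mpr (norm_ne_zero_iff.mpr hx)
    have hp := Complex.ofReal_ne_zero.mpr Real.pi_ne_zero
    simp only [kern, hP]
    push_cast
    field_simp
    ring
  · filter_upwards [hne] with x hx
    have hr : (‖x‖ : ℂ) ≠ 0 := Complex.ofReal_ne_zero.mpr (norm_ne_zero_iff.mpr hx)
    have hp := Complex.ofReal_ne_zero.mpr Real.pi_ne_zero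
    simp only [hP, norm_smul, PiLp.smul_apply, smul_eq_mul, Real.norm_of_nonneg (by positivity : 0 ≤ 2 * Real.pi)]
    push_cast
    field_simp
    ring

/-! ### Linearity of Fourier pairs -/

theorem IsGivenBy.add {S T : 𝓢'(E3, ℂ)} {f g : E3 → ℝ} (hS : IsGivenBy S f)
    (hT : IsGivenBy T g) : IsGivenBy (S + T) (fun x => f x + g x) := by
  intro φ
  have e : (fun x => φ x * ((f x + g x : ℝ) : ℂ)) = fun x => φ x * (f x : ℂ) + φ x * (g x : ℂ) := by
    funext x; push_cast; ring
  rw [e]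
  refine ⟨(hS φ).1.add (hT φ).1, ?_⟩
  rw [integral_add (hS φ).1 (hT φ).1, ← (hS φ).2, ← (hT φ).2]
  rfl

theorem IsGivenBy.const_mul {T : 𝓢'(E3, ℂ)} {f : E3 → ℝ} (hT : IsGivenBy T f) (c : ℝ) :
    IsGivenBy ((c : ℂ) • T) (fun x => c * f x) := by
  intro φ
  have e : (fun x => φ x * ((c * f x : ℝ) : ℂ)) = fun x => (c : ℂ) * (φ x * (f x : ℂ)) := by
    funext x; push_cast; ring
  rw [e]
  refine ⟨(hT φ).1.const_mul _, ?_⟩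
  rw [integral_const_mul, ← (hT φ).2]
  rfl

theorem IsFourierPair.add {f₁ f₂ g₁ g₂ : E3 → ℝ} (h₁ : IsFourierPair f₁ g₁)
    (h₂ : IsFourierPair f₂ g₂) :
    IsFourierPair (fun x => f₁ x + f₂ x) (fun ξ => g₁ ξ + g₂ ξ) := by
  obtain ⟨S, hS, hS'⟩ := h₁
  obtain ⟨T, hT, hT'⟩ := h₂
  exact ⟨S + T, hS.add hT, by rw [FourierTransform.fourier_add]; exact hS'.add hT'⟩

theorem IsFourierPair.const_mul {f g : E3 → ℝ} (h : IsFourierPair f g) (c : ℝ) :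
    IsFourierPair (fun x => c * f x) (fun ξ => c * g ξ) := by
  obtain ⟨S, hS, hS'⟩ := h
  exact ⟨(c : ℂ) • S, hS.const_mul c, by
    rw [FourierTransform.fourier_smul]; exact hS'.const_mul c⟩

theorem isFourierPair_zero : IsFourierPair (fun _ => 0) (fun _ => 0) := by
  have h : IsGivenBy 0 (fun _ => 0) := fun φ => by simp
  exact ⟨0, h, by rw [FourierTransform.fourier_zero]; exact h⟩

theorem isFourierPair_of_integral_eq {f g : E3 → ℝ} (hf : ∃ T, IsGivenBy T f)
    (hg : ∃ T, IsGivenBy T (fun η => g ((2 * Real.pi) • η)))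
    (h : ∀ φ : 𝓢(E3, ℂ), ∫ x, 𝓕 φ x * (f x : ℂ) =
      ∫ η, φ η * (g ((2 * Real.pi) • η) : ℂ)) : IsFourierPair f g := by
  obtain ⟨T, hT⟩ := hf
  obtain ⟨S, hS⟩ := hg
  refine ⟨T, hT, fun φ => ⟨(hS φ).1, ?_⟩⟩
  rw [TemperedDistribution.fourier_apply, (hT _).2, h]

theorem exists_isGivenBy_kern (i j k l : Fin 3) : ∃ T, IsGivenBy T (kern i j k l) := by
  have hm6 := measurable_sumSix i j k l
  obtain ⟨T₁, h₁⟩ := exists_isGivenBy_of_le (by fun_prop) (abs_mul_div_norm_pow_le (d := 4) (a := 1)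
    (.inl rfl) (abs_quartic_le i j k l) (3 / (32 * Real.pi)))
  obtain ⟨T₂, h₂⟩ := exists_isGivenBy_of_le (by fun_prop) (abs_mul_div_norm_pow_le (d := 2) (a := 1)
    (.inl rfl) (abs_sumSix_le i j k l) (-1 / (32 * Real.pi)))
  obtain ⟨T₃, h₃⟩ := exists_isGivenBy_of_le (by fun_prop) (abs_mul_div_norm_pow_le (d := 0) (a := 1)
    (h := fun _ => sumThree i j k l) (A := |sumThree i j k l|)
    (.inl rfl) (fun x => by simp) (1 / (32 * Real.pi)))
  refine ⟨T₁ + T₂ + T₃, ?_⟩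
  convert! (h₁.add h₂).add h₃ using 1
  funext x
  rcases eq_or_ne x 0 with rfl | hx
  · simp [kern]
  have hr := norm_ne_zero_iff.mpr hx
  have hp := Real.pi_ne_zero
  simp only [kern]
  field_simp
  ring

theorem isFourierPair_kern (i j k l : Fin 3) :
    IsFourierPair (kern i j k l) (fun ξ => ξ i * ξ j * ξ k * ξ l / ‖ξ‖ ^ 6) := by
  refine isFourierPair_of_integral_eq (exists_isGivenBy_kern i j k l) ?_
    (fun φ => integral_fourier_mul_kern φ i j k l)
  -- Rescaling by `2π` gives four factors in the numerator and six in the denominator, hence `1 /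
  -- (2π)²`.
  obtain ⟨T, h⟩ := exists_isGivenBy_of_le (by fun_prop) (abs_mul_div_norm_pow_le (d := 4) (a := 2)
    (.inr rfl) (abs_quartic_le i j k l) (1 / (2 * Real.pi) ^ 2))
  refine ⟨T, ?_⟩
  convert! h using 1
  funext x
  rcases eq_or_ne x 0 with rfl | hx
  · simp
  have hr := norm_ne_zero_iff.mpr hx
  have hp := Real.pi_ne_zero
  simp only [norm_smul, PiLp.smul_apply, smul_eq_mul,
    Real.norm_of_nonneg (by positivity : 0 ≤ 2 * Real.pi)]
  field_simp

/-! ### The inverse symbol as a tensor contraction -/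

/-- The linear combination of components of a quartic tensor `M` which, for `M = ξ ⊗ ξ ⊗ ξ ⊗ ξ`,
gives the numerator of component `a` of the inverse of
the symbol applied to `q`. -/
noncomputable def quarticForm {V : Type*} [AddCommGroup V] [Module ℝ V] (k : ℝ) (a : Fin 6)
    (q : Fin 6 → ℝ) (M : Fin 3 → Fin 3 → Fin 3 → Fin 3 → V) : V :=
  let E : Matrix (Fin 3) (Fin 3) ℝ := symMat q
  let i := (pair a).1
  let j := (pair a).2
  ((2 + k) * (3 + 2 * k) * E i j) • ∑ m, ∑ l, M m m l l
    - (k * (3 + 2 * k)) • ∑ m, ∑ l, (E j m • M l l i m + E i m • M l l j m)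
    + (k * (2 + k) * E.trace) • ∑ l, M l l i j
    + (k ^ 2) • ∑ m, ∑ l, E m l • M i j m l

theorem quarticForm_mem {V : Type*} [AddCommGroup V] [Module ℝ V] (S : Submodule ℝ V) (k : ℝ)
    (a : Fin 6) (q : Fin 6 → ℝ) {M : Fin 3 → Fin 3 → Fin 3 → Fin 3 → V} (hM : ∀ i j m l, M i j m l ∈ S) :
    quarticForm k a q M ∈ S := by
  refine S.add_mem (S.add_mem (S.sub_mem ?_ ?_) ?_) ?_ <;> refine S.smul_mem _ ?_
  · exact S.sum_mem fun _ _ => S.sum_mem fun _ _ => hM _ _ _ _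
  · exact S.sum_mem fun _ _ => S.sum_mem fun _ _ =>
      S.add_mem (S.smul_mem _ (hM _ _ _ _)) (S.smul_mem _ (hM _ _ _ _))
  · exact S.sum_mem fun _ _ => hM _ _ _ _
  · exact S.sum_mem fun _ _ => S.sum_mem fun _ _ => S.smul_mem _ (hM _ _ _ _)

theorem map_quarticForm {V W : Type*} [AddCommGroup V] [Module ℝ V] [AddCommGroup W] [Module ℝ W]
    (L : V →ₗ[ℝ] W) (k : ℝ) (a : Fin 6) (q : Fin 6 → ℝ)
    (M : Fin 3 → Fin 3 → Fin 3 → Fin 3 → V) :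
    L (quarticForm k a q M) = quarticForm k a q (fun i j m l => L (M i j m l)) := by
  simp only [quarticForm, map_add, map_sub, map_smul, map_sum]

/-- The Fourier pairs form a linear space. -/
def fourierPairs : Submodule ℝ ((E3 → ℝ) × (E3 → ℝ)) where
  carrier := {q | IsFourierPair q.1 q.2}
  add_mem' h₁ h₂ := h₁.add h₂
  zero_mem' := isFourierPair_zero
  smul_mem' c _ h := h.const_mul c

/-- The contraction is formed in the product space of pairs `(f, g)`, where being a Fourier pair is
membership in a subspace; the two projections then recover both sides. -/
theorem IsFourierPair.quarticForm {f g : Fin 3 → Fin 3 → Fin 3 → Fin 3 → E3 → ℝ}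
    (h : ∀ i j m l, IsFourierPair (f i j m l) (g i j m l)) (k : ℝ) (a : Fin 6) (q : Fin 6 → ℝ) :
    IsFourierPair (fun x => LiquidCrystal.quarticForm k a q (fun i j m l => f i j m l x))
      (fun ξ => LiquidCrystal.quarticForm k a q (fun i j m l => g i j m l ξ)) := by
  have h' : IsFourierPair _ _ := quarticForm_mem fourierPairs k a q
    (M := fun i j m l => (f i j m l, g i j m l)) h
  have h₁ := map_quarticForm (LinearMap.fst ℝ (E3 → ℝ) (E3 → ℝ)) k a q
    (fun i j m l => (f i j m l, g i j m l))
  have h₂ := map_quarticForm (LinearMap.snd ℝ (E3 → ℝ) (E3 → ℝ)) k a q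
    (fun i j m l => (f i j m l, g i j m l))
  simp only [LinearMap.fst_apply, LinearMap.snd_apply] at h₁ h₂
  rw [h₁, h₂] at h'
  exact h'

/-- The monomial `Xᵢ Xⱼ Xₘ Xₗ`. -/
noncomputable def monPoly (i j m l : Fin 3) : MvPolynomial (Fin 3) ℝ :=
  MvPolynomial.X i * MvPolynomial.X j * MvPolynomial.X m * MvPolynomial.X l

theorem isHomogeneous_monPoly (i j m l : Fin 3) : (monPoly i j m l).IsHomogeneous 4 :=
  (((MvPolynomial.isHomogeneous_X ℝ i).mul (MvPolynomial.isHomogeneous_X ℝ j)).mul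
    (MvPolynomial.isHomogeneous_X ℝ m)).mul (MvPolynomial.isHomogeneous_X ℝ l)

/-- The numerator of `kern`. -/
noncomputable def kernPoly (i j m l : Fin 3) : MvPolynomial (Fin 3) ℝ :=
  (3 : ℝ) • monPoly i j m l
    - ∑ s, (kd i j • monPoly s s m l + kd i m • monPoly s s j l + kd i l • monPoly s s j m
      + kd j m • monPoly s s i l + kd j l • monPoly s s i m + kd m l • monPoly s s i j)
    + sumThree i j m l • ∑ s, ∑ t, monPoly s s t t

/-- Since `r²` is expanded as a sum of squares, each term is a multiple of a quartic monomial, and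
homogeneity is membership in a subspace. -/
theorem isHomogeneous_kernPoly (i j m l : Fin 3) : (kernPoly i j m l).IsHomogeneous 4 := by
  have h : ∀ i j m l, monPoly i j m l ∈ MvPolynomial.homogeneousSubmodule (Fin 3) ℝ 4 :=
    isHomogeneous_monPoly
  let S := MvPolynomial.homogeneousSubmodule (Fin 3) ℝ 4
  change kernPoly i j m l ∈ S
  refine S.add_mem (S.sub_mem (S.smul_mem _ (h ..)) (S.sum_mem fun s _ => ?_))
    (S.smul_mem _ (S.sum_mem fun s _ => S.sum_mem fun t _ => h ..))
  exact S.add_mem (S.add_mem (S.add_mem (S.add_mem (S.add_mem (S.smul_mem _ (h ..))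
    (S.smul_mem _ (h ..))) (S.smul_mem _ (h ..))) (S.smul_mem _ (h ..)))
    (S.smul_mem _ (h ..))) (S.smul_mem _ (h ..))

/-- Evaluation of polynomials, as a linear map. -/
noncomputable def evalLin (v : Fin 3 → ℝ) : MvPolynomial (Fin 3) ℝ →ₗ[ℝ] ℝ :=
  (MvPolynomial.aeval v).toLinearMap

theorem evalLin_apply (v : Fin 3 → ℝ) (P : MvPolynomial (Fin 3) ℝ) :
    evalLin v P = MvPolynomial.eval v P := by
  exact congrArg (fun f : MvPolynomial (Fin 3) ℝ →+* ℝ => f P) (MvPolynomial.coe_aeval_eq_eval v)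

theorem eval_monPoly (v : Fin 3 → ℝ) (i j m l : Fin 3) :
    MvPolynomial.eval v (monPoly i j m l) = v i * v j * v m * v l := by
  simp [monPoly]

theorem norm_sq_eq (x : E3) : ‖x‖ ^ 2 = x 0 ^ 2 + x 1 ^ 2 + x 2 ^ 2 := by
  rw [EuclideanSpace.real_norm_sq_eq, Fin.sum_univ_three]

theorem eval_kernPoly (v : Fin 3 → ℝ) (i j m l : Fin 3) :
    MvPolynomial.eval v (kernPoly i j m l) =
      3 * (v i * v j * v m * v l) - (v 0 ^ 2 + v 1 ^ 2 + v 2 ^ 2) *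
        (kd i j * v m * v l + kd i m * v j * v l + kd i l * v j * v m
          + kd j m * v i * v l + kd j l * v i * v m + kd m l * v i * v j)
        + (v 0 ^ 2 + v 1 ^ 2 + v 2 ^ 2) ^ 2 * sumThree i j m l := by
  simp only [kernPoly, map_add, map_sub, MvPolynomial.smul_eval, eval_monPoly, Fin.sum_univ_three]
  ring

theorem kern_eq (x : E3) (i j m l : Fin 3) : kern i j m l x =
    (32 * Real.pi * ‖x‖ ^ 5)⁻¹ * MvPolynomial.eval (fun i => x i) (kernPoly i j m l) := by
  have h4 : ‖x‖ ^ 4 = (‖x‖ ^ 2) ^ 2 := by ring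
  rw [kern, eval_kernPoly, h4, norm_sq_eq, sumSix, div_eq_inv_mul]

theorem map_numerator {R S : Type*} [CommRing R] [CommRing S] (f : R →+* S) (K x y z : R)
    (p a : Fin 6) : f (numerator K x y z p a) = numerator (f K) (f x) (f y) (f z) p a := by
  fin_cases p
  · change f (num11 K x y z a) = num11 (f K) (f x) (f y) (f z) a
    fin_cases a <;> simp [num11, map_ofNat f]
  · change f (num22 K x y z a) = num22 (f K) (f x) (f y) (f z) a
    fin_cases a <;> simp [num22, map_ofNat f]
  · change f (num33 K x y z a) = num33 (f K) (f x) (f y) (f z) a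
    fin_cases a <;> simp [num33, map_ofNat f]
  · change f (num12 K x y z a) = num12 (f K) (f x) (f y) (f z) a
    fin_cases a <;> simp [num12, map_ofNat f]
  · change f (num13 K x y z a) = num13 (f K) (f x) (f y) (f z) a
    fin_cases a <;> simp [num13, map_ofNat f]
  · change f (num23 K x y z a) = num23 (f K) (f x) (f y) (f z) a
    fin_cases a <;> simp [num23, map_ofNat f]

theorem eval_fundNum (k : ℝ) (p a : Fin 6) (v : Fin 3 → ℝ) :
    MvPolynomial.eval v (fundNum k p a) = numerator k (v 0) (v 1) (v 2) p a := by
  rw [fundNum, map_numerator]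
  simp

-- This identity ties the explicit table to the contraction. Keeping `q` arbitrary treats the six
-- solutions together, component by component.
set_option maxHeartbeats 8000000 in
theorem sum_mul_numerator (k : ℝ) (a : Fin 6) (q : Fin 6 → ℝ) (v : Fin 3 → ℝ) :
    ∑ p, q p * numerator k (v 0) (v 1) (v 2) p a =
      quarticForm k a q (fun i j m l => MvPolynomial.eval v (kernPoly i j m l)) := by
  simp only [eval_kernPoly]
  fin_cases a <;>
    simp [quarticForm, numerator, num11, num22, num33, num12, num13, num23, sumThree,
      kd, symMat, pair, Fin.sum_univ_succ, Matrix.trace] <;> ring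

theorem fundNum_eq_quarticForm (k : ℝ) (p a : Fin 6) :
    fundNum k p a = quarticForm k a (Pi.single p 1) kernPoly := by
  -- Over the infinite field `ℝ`, equality of polynomials may be checked on values.
  refine MvPolynomial.funext fun v => ?_
  rw [eval_fundNum, ← evalLin_apply, map_quarticForm]
  simp only [evalLin_apply]
  rw [← sum_mul_numerator]
  simp [Pi.single_apply]

theorem isHomogeneous_fundNum (k : ℝ) (p a : Fin 6) : (fundNum k p a).IsHomogeneous 4 := by
  rw [fundNum_eq_quarticForm]
  exact quarticForm_mem (MvPolynomial.homogeneousSubmodule (Fin 3) ℝ 4) k a _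
    isHomogeneous_kernPoly

theorem fundSol_eq (k : ℝ) (p a : Fin 6) (x : E3) : fundSol k p a x =
    1 / ((2 + k) * (3 + 2 * k)) *
      quarticForm k a (Pi.single p 1) (fun i j m l => kern i j m l x) := by
  have h : ∀ i j m l, kern i j m l x = ((32 * Real.pi * ‖x‖ ^ 5)⁻¹ • evalLin (fun i => x i))
      (kernPoly i j m l) := fun i j m l => by
    rw [LinearMap.smul_apply, evalLin_apply, kern_eq, smul_eq_mul]
  simp only [h]
  rw [← map_quarticForm, ← fundNum_eq_quarticForm, LinearMap.smul_apply, evalLin_apply, fundSol,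
    smul_eq_mul, div_eq_mul_inv]
  simp only [mul_inv, one_div]
  ring_nf

-- The inverse formula is checked in denominator-free form, so it holds for all `k` and `ξ`. In
-- solving for `Q`, the factor `2 + k` comes from the equation for `Qξ`, and `3 + 2k` from the
-- determinant of the system for `Tr Q` and `ξ·Qξ`.
set_option maxHeartbeats 8000000 in
theorem symbol_mul_quarticForm (k : ℝ) (ξ : E3) (a : Fin 6) (q : Fin 6 → ℝ) :
    ∑ b, symbol k ξ a b * quarticForm k b q (fun i j m l => ξ i * ξ j * ξ m * ξ l) =
      (2 + k) * (3 + 2 * k) * ‖ξ‖ ^ 6 * q a := by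
  have h6 : ‖ξ‖ ^ 6 = (‖ξ‖ ^ 2) ^ 3 := by ring
  rw [h6, norm_sq_eq]
  fin_cases a <;>
    simp [quarticForm, symbol, symMat, pair, Fin.sum_univ_succ, Matrix.trace] <;> ring

theorem isFourierPair_fundSol_quarticForm (k : ℝ) (p a : Fin 6) :
    IsFourierPair (fundSol k p a) (fun ξ => 1 / ((2 + k) * (3 + 2 * k)) *
      quarticForm k a (Pi.single p 1) (fun i j m l => ξ i * ξ j * ξ m * ξ l / ‖ξ‖ ^ 6)) := by
  have h := (IsFourierPair.quarticForm isFourierPair_kern k a (Pi.single p 1)).const_mul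
    (1 / ((2 + k) * (3 + 2 * k)))
  rwa [← funext fun x => fundSol_eq k p a x] at h

theorem quarticForm_div (k : ℝ) (a : Fin 6) (q : Fin 6 → ℝ)
    (M : Fin 3 → Fin 3 → Fin 3 → Fin 3 → ℝ) (c : ℝ) :
    quarticForm k a q (fun i j m l => M i j m l / c) = quarticForm k a q M / c := by
  have := map_quarticForm (c⁻¹ • (LinearMap.id : ℝ →ₗ[ℝ] ℝ)) k a q M
  simp only [LinearMap.smul_apply, LinearMap.id_apply, smul_eq_mul] at this
  simp only [div_eq_inv_mul, this]

/-- The numerators of the entries of the inverse of the symbol. -/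
noncomputable def invNum (k : ℝ) (a p : Fin 6) : MvPolynomial (Fin 3) ℝ :=
  quarticForm k a (Pi.single p 1) monPoly

theorem isHomogeneous_invNum (k : ℝ) (a p : Fin 6) : (invNum k a p).IsHomogeneous 4 :=
  quarticForm_mem (MvPolynomial.homogeneousSubmodule (Fin 3) ℝ 4) k a _ isHomogeneous_monPoly

theorem eval_invNum (k : ℝ) (a p : Fin 6) (v : Fin 3 → ℝ) :
    MvPolynomial.eval v (invNum k a p) =
      quarticForm k a (Pi.single p 1) (fun i j m l => v i * v j * v m * v l) := by
  rw [invNum, ← evalLin_apply, map_quarticForm]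
  simp only [evalLin_apply, eval_monPoly]

theorem symbol_mul_inverse {k : ℝ} (hk₁ : k ≠ -2) (hk₂ : k ≠ -3 / 2) {ξ : E3} (hξ : ξ ≠ 0) :
    symbol k ξ * Matrix.of (fun a p => MvPolynomial.eval (fun i => ξ i) (invNum k a p) /
      ((2 + k) * (3 + 2 * k) * ‖ξ‖ ^ 6)) = 1 := by
  have h1 : 2 + k ≠ 0 := fun h => hk₁ (by linarith)
  have h2 : 3 + 2 * k ≠ 0 := fun h => hk₂ (by linarith)
  have hr := norm_ne_zero_iff.mpr hξ
  ext a p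
  simp only [Matrix.mul_apply, Matrix.of_apply, eval_invNum, ← mul_div_assoc]
  rw [← Finset.sum_div, symbol_mul_quarticForm, mul_div_assoc, mul_comm, div_mul_cancel₀]
  · simp [Matrix.one_apply, Pi.single_apply]
  · exact mul_ne_zero (mul_ne_zero h1 h2) (pow_ne_zero 6 hr)

theorem isUnit_det_symbol {k : ℝ} (hk₁ : k ≠ -2) (hk₂ : k ≠ -3 / 2) {ξ : E3} (hξ : ξ ≠ 0) :
    IsUnit (symbol k ξ).det :=
  Matrix.isUnit_det_of_right_inverse (symbol_mul_inverse hk₁ hk₂ hξ)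

theorem symbol_inv_apply {k : ℝ} (hk₁ : k ≠ -2) (hk₂ : k ≠ -3 / 2) {ξ : E3} (hξ : ξ ≠ 0)
    (a p : Fin 6) : (symbol k ξ)⁻¹ a p = MvPolynomial.eval (fun i => ξ i) (invNum k a p) /
      ((2 + k) * (3 + 2 * k) * ‖ξ‖ ^ 6) := by
  rw [Matrix.inv_eq_right_inv (symbol_mul_inverse hk₁ hk₂ hξ), Matrix.of_apply]

theorem symbol_zero (k : ℝ) : symbol k 0 = 0 := by
  ext a b
  fin_cases a <;> fin_cases b <;> simp [symbol]

theorem isFourierPair_fundSol {k : ℝ} (hk₁ : k ≠ -2) (hk₂ : k ≠ -3 / 2) (p a : Fin 6) :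
    IsFourierPair (fundSol k p a)
      (fun ξ => ((symbol k ξ)⁻¹.mulVec (Pi.single p 1)) a) := by
  have h := isFourierPair_fundSol_quarticForm k p a
  convert! h using 1
  funext ξ
  rw [quarticForm_div, Matrix.mulVec_single_one, Matrix.col_apply]
  -- At the origin both sides are `0`: the symbol vanishes, the inverse of a singular matrix is `0`
  -- by convention, and so is division by `‖0‖ ^ 6`.
  rcases eq_or_ne ξ 0 with rfl | hξ
  · simp [symbol_zero]
  · rw [symbol_inv_apply hk₁ hk₂ hξ, eval_invNum, div_mul_div_comm, one_mul]

/-! ### Explicit transforms of monomials and the case `k = 0` -/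

theorem norm_sq_perm (σ : Equiv.Perm (Fin 3)) (x : E3) :
    ‖x‖ ^ 2 = x (σ 0) ^ 2 + x (σ 1) ^ 2 + x (σ 2) ^ 2 := by
  rw [EuclideanSpace.real_norm_sq_eq, ← Equiv.sum_comp σ, Fin.sum_univ_three]

theorem isFourierPair_monomials (σ : Equiv.Perm (Fin 3)) :
    IsFourierPair
        (fun x => -3 * x (σ 0) * x (σ 1) * (x (σ 1) ^ 2 + x (σ 2) ^ 2)
          / (32 * Real.pi * ‖x‖ ^ 5))
        (fun ξ => ξ (σ 0) ^ 3 * ξ (σ 1) / ‖ξ‖ ^ 6) ∧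
      IsFourierPair
        (fun x => x (σ 1) * x (σ 2) * (2 * x (σ 0) ^ 2 - x (σ 1) ^ 2 - x (σ 2) ^ 2)
          / (32 * Real.pi * ‖x‖ ^ 5))
        (fun ξ => ξ (σ 0) ^ 2 * ξ (σ 1) * ξ (σ 2) / ‖ξ‖ ^ 6) ∧
      IsFourierPair
        (fun x => 3 * (x (σ 1) ^ 2 + x (σ 2) ^ 2) ^ 2 / (32 * Real.pi * ‖x‖ ^ 5))
        (fun ξ => ξ (σ 0) ^ 4 / ‖ξ‖ ^ 6) ∧
      IsFourierPair
        (fun x => (3 * x (σ 0) ^ 2 * x (σ 1) ^ 2 + ‖x‖ ^ 2 * x (σ 2) ^ 2)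
          / (32 * Real.pi * ‖x‖ ^ 5))
        (fun ξ => ξ (σ 0) ^ 2 * ξ (σ 1) ^ 2 / ‖ξ‖ ^ 6) := by
  have h01 : kd (σ 0) (σ 1) = 0 := by simp [kd]
  have h02 : kd (σ 0) (σ 2) = 0 := by simp [kd]
  have h12 : kd (σ 1) (σ 2) = 0 := by simp [kd]
  have hs : ∀ i, kd i i = 1 := fun i => by simp [kd]
  have h4 : ∀ x : E3, ‖x‖ ^ 4 = (‖x‖ ^ 2) ^ 2 := fun x => by ring
  have key : ∀ (i j m l : Fin 3) {f g : E3 → ℝ}, (∀ x : E3, 3 * (x i * x j * x m * x l) -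
      ‖x‖ ^ 2 * sumSix i j m l x + ‖x‖ ^ 4 * sumThree i j m l = f x) →
      (∀ x : E3, x i * x j * x m * x l = g x) →
      IsFourierPair (fun x => f x / (32 * Real.pi * ‖x‖ ^ 5)) (fun ξ => g ξ / ‖ξ‖ ^ 6) := by
    intro i j m l f g hf hg
    simp only [← hf, ← hg]
    exact isFourierPair_kern i j m l
  refine ⟨key (σ 0) (σ 0) (σ 0) (σ 1) (fun x => ?_) fun x => by ring,
    key (σ 0) (σ 0) (σ 1) (σ 2) (fun x => ?_) fun x => by ring,
    key (σ 0) (σ 0) (σ 0) (σ 0) (fun x => ?_) fun x => by ring,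
    key (σ 0) (σ 0) (σ 1) (σ 1) (fun x => ?_) fun x => by ring⟩ <;>
  · simp only [sumSix, sumThree, hs, h01, h02, h12]
    rw [h4, norm_sq_perm σ]
    ring

theorem fundSol_zero (p a : Fin 6) {x : E3} (hx : x ≠ 0) :
    fundSol 0 p a x = 1 / (4 * Real.pi * ‖x‖) * (Pi.single p 1 : Fin 6 → ℝ) a := by
  have hr := norm_ne_zero_iff.mpr hx
  have hp := Real.pi_ne_zero
  have h : numerator (0 : ℝ) (x 0) (x 1) (x 2) p a =
      48 * ‖x‖ ^ 4 * (Pi.single p 1 : Fin 6 → ℝ) a := by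
    have h4 : ‖x‖ ^ 4 = (‖x‖ ^ 2) ^ 2 := by ring
    rw [h4, norm_sq_eq]
    fin_cases p <;> fin_cases a <;>
      simp [numerator, num11, num22, num33, num12, num13, num23] <;> ring
  rw [fundSol, eval_fundNum, h]
  field_simp
  ring

/-! ### The operator in index form and the equation for the delta -/

section IndexForm

variable {V W : Type*} [AddCommGroup V] [Module ℝ V] [AddCommGroup W] [Module ℝ W]

/-- The contraction pattern of `D*` in index notation: `Y a b c d` stands for
`-∂ₐ ∂_b Q_{cd}`, or for `ξₐ ξ_b Q_{cd}`. -/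
noncomputable def indexForm (k : ℝ) (Y : Fin 3 → Fin 3 → Fin 3 → Fin 3 → V) (i j : Fin 3) : V :=
  ∑ m, Y m m i j + (k / 2) • (∑ l, Y i l l j + ∑ l, Y j l l i - (2 / 3 : ℝ) • ∑ m, Y i j m m)

theorem indexForm_mem (S : Submodule ℝ V) (k : ℝ) {Y : Fin 3 → Fin 3 → Fin 3 → Fin 3 → V}
    (hY : ∀ a b c d, Y a b c d ∈ S) (i j : Fin 3) : indexForm k Y i j ∈ S :=
  S.add_mem (S.sum_mem fun _ _ => hY _ _ _ _) (S.smul_mem _ (S.sub_mem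
    (S.add_mem (S.sum_mem fun _ _ => hY _ _ _ _) (S.sum_mem fun _ _ => hY _ _ _ _))
    (S.smul_mem _ (S.sum_mem fun _ _ => hY _ _ _ _))))

theorem map_indexForm (L : V →ₗ[ℝ] W) (k : ℝ) (Y : Fin 3 → Fin 3 → Fin 3 → Fin 3 → V)
    (i j : Fin 3) :
    L (indexForm k Y i j) = indexForm k (fun a b c d => L (Y a b c d)) i j := by
  simp only [indexForm, map_add, map_sub, map_smul, map_sum]

/-- The operator and its symbol become one contraction applied to different tensors, so a linear map
such as the Fourier transform need only be computed on second derivatives. The Laplacian formula is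
a hypothesis so that Schwartz functions and tempered distributions share the lemma. -/
theorem adjointOp_eq_indexForm [LineDeriv E3 V V] [Laplacian V V] [LineDerivAdd E3 V V]
    (hΔ : ∀ v : V, Δ v = ∑ i, ∂_{e i} (∂_{e i} v)) (k : ℝ) (Q : Matrix (Fin 3) (Fin 3) V)
    (i j : Fin 3) :
    adjointOp k Q i j = indexForm k (fun a b c d => -∂_{e a} (∂_{e b} (Q c d))) i j := by
  simp only [adjointOp, indexForm, matDiv, Matrix.of_apply, hΔ, Matrix.trace, Matrix.diag_apply,
    lineDerivOp_sum, Finset.sum_neg_distrib]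
  module

end IndexForm

theorem symMat_map {V W : Type*} (f : V → W) (q : Fin 6 → V) (i j : Fin 3) :
    f (symMat q i j) = symMat (fun a => f (q a)) i j := by
  fin_cases i <;> fin_cases j <;> rfl

theorem symMat_pair {V : Type*} (q : Fin 6 → V) (a : Fin 6) :
    symMat q (pair a).1 (pair a).2 = q a := by
  fin_cases a <;> rfl

theorem indexForm_symMat (k : ℝ) (ξ : E3) (q : Fin 6 → ℂ) (i j : Fin 3) :
    indexForm k (fun a b c d => ((ξ a * ξ b : ℝ) : ℂ) * symMat q c d) i j =
      symMat (fun a => ∑ b, (symbol k ξ a b : ℂ) * q b) i j := by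
  fin_cases i <;> fin_cases j <;>
    simp [indexForm, symMat, symbol, Fin.sum_univ_succ] <;> ring

theorem fourier_lineDeriv_lineDeriv (φ : 𝓢(E3, ℂ)) (i j : Fin 3) (η : E3) :
    𝓕 (∂_{e i} (∂_{e j} φ)) η =
      -(((((2 * Real.pi) • η) i * ((2 * Real.pi) • η) j : ℝ) : ℂ) * 𝓕 φ η) := by
  simp only [fourier_lineDeriv, smul_apply, mulCoord_apply, smul_eq_mul, PiLp.smul_apply]
  push_cast
  linear_combination (4 * (Real.pi : ℂ) ^ 2 * η i * η j * 𝓕 φ η) * Complex.I_sq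

theorem laplacian_schwartz (φ : 𝓢(E3, ℂ)) : Δ φ = ∑ i, ∂_{e i} (∂_{e i} φ) := by
  rw [SchwartzMap.laplacian_eq_sum (EuclideanSpace.basisFun (Fin 3) ℝ)]
  simp [e]

theorem laplacian_tempered (T : 𝓢'(E3, ℂ)) : Δ T = ∑ i, ∂_{e i} (∂_{e i} T) := by
  rw [TemperedDistribution.laplacian_eq_sum (EuclideanSpace.basisFun (Fin 3) ℝ)]
  simp [e]

theorem fourier_adjointOp (k : ℝ) (Q : Fin 6 → 𝓢(E3, ℂ)) (a : Fin 6) (η : E3) :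
    𝓕 (adjointOp k (symMat Q) (pair a).1 (pair a).2) η =
      ∑ b, (symbol k ((2 * Real.pi) • η) a b : ℂ) * 𝓕 (Q b) η := by
  let L : 𝓢(E3, ℂ) →ₗ[ℝ] ℂ :=
    { toFun := fun φ => 𝓕 φ η
      map_add' := fun φ ψ => by rw [FourierTransform.fourier_add]; rfl
      map_smul' := fun c φ => by
        have := FourierTransform.fourier_smul (c : ℂ) φ
        have h2 : c • φ = (c : ℂ) • φ := by ext; simp
        rw [h2, this]; simp }
  have h := indexForm_symMat k ((2 * Real.pi) • η) (fun b => 𝓕 (Q b) η) (pair a).1 (pair a).2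
  rw [symMat_pair] at h
  rw [← h]
  have h1 := map_indexForm L k (fun a b c d => -∂_{e a} (∂_{e b} (symMat Q c d)))
    (pair a).1 (pair a).2
  rw [← adjointOp_eq_indexForm laplacian_schwartz] at h1
  refine h1.trans ?_
  congr 1
  funext a b c d
  rw [map_neg]
  change -(𝓕 (∂_{e a} (∂_{e b} (symMat Q c d))) η) = _
  rw [fourier_lineDeriv_lineDeriv, neg_neg, ← symMat_map fun φ : 𝓢(E3, ℂ) => 𝓕 φ η]

/-- The pairs of an integral and an integrable function with this integral. -/
def integralPairs : Submodule ℝ (ℂ × (E3 → ℂ)) where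
  carrier := {q | Integrable q.2 ∧ ∫ x, q.2 x = q.1}
  add_mem' h₁ h₂ := ⟨h₁.1.add h₂.1, by
    rw [Prod.fst_add, ← h₁.2, ← h₂.2, ← integral_add h₁.1 h₂.1]; rfl⟩
  zero_mem' := ⟨integrable_zero _ _ _, by simp⟩
  smul_mem' c q h := ⟨by rw [Prod.smul_snd]; exact h.1.smul c, by
    rw [Prod.smul_fst, ← h.2, ← integral_smul]; rfl⟩

theorem lineDeriv_lineDeriv_fourier (φ : 𝓢(E3, ℂ)) (i j : Fin 3) :
    ∂_{e i} (∂_{e j} (𝓕 φ)) =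
      -𝓕 (((2 * Real.pi : ℝ) : ℂ) ^ 2 • mulCoord i (mulCoord j φ)) := by
  rw [← FourierTransform.fourier_neg]
  simp only [lineDeriv_fourier]
  congr 1
  ext x
  simp only [smul_apply, neg_apply, mulCoord_apply, smul_eq_mul]
  push_cast
  linear_combination (4 * (Real.pi : ℂ) ^ 2 * x i * x j * φ x) * Complex.I_sq

/-- Both derivatives move onto `𝓕 φ`, where they become multiplication by coordinates inside the
transform; `T (𝓕 ·) = 𝓕 T (·)` then exposes the density `g`. -/
theorem lineDeriv_lineDeriv_apply_fourier {T : 𝓢'(E3, ℂ)} {g : E3 → ℝ}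
    (h : IsGivenBy (𝓕 T) (fun η => g ((2 * Real.pi) • η))) (i j : Fin 3) (φ : 𝓢(E3, ℂ)) :
    ((-∂_{e i} (∂_{e j} T)) (𝓕 φ), fun η : E3 =>
      ((((2 * Real.pi) • η) i * ((2 * Real.pi) • η) j : ℝ) : ℂ) *
        (g ((2 * Real.pi) • η) * φ η)) ∈ integralPairs := by
  have h1 := h (((2 * Real.pi : ℝ) : ℂ) ^ 2 • mulCoord j (mulCoord i φ))
  have e1 : (-∂_{e i} (∂_{e j} T)) (𝓕 φ) =
      𝓕 T (((2 * Real.pi : ℝ) : ℂ) ^ 2 • mulCoord j (mulCoord i φ)) := by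
    rw [TemperedDistribution.fourier_apply]
    change -(T (-∂_{e j} (-∂_{e i} (𝓕 φ)))) = _
    rw [lineDerivOp_neg, neg_neg, lineDeriv_lineDeriv_fourier, map_neg, neg_neg]
  have e2 : (fun η : E3 => ((((2 * Real.pi) • η) i * ((2 * Real.pi) • η) j : ℝ) : ℂ) *
        (g ((2 * Real.pi) • η) * φ η)) = fun η =>
      (((2 * Real.pi : ℝ) : ℂ) ^ 2 • mulCoord j (mulCoord i φ)) η * g ((2 * Real.pi) • η) := by
    funext η
    simp only [smul_apply, mulCoord_apply, smul_eq_mul, PiLp.smul_apply]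
    push_cast; ring
  rw [e1, e2]
  exact ⟨h1.1, h1.2.symm⟩

theorem adjointOp_eq_delta {k : ℝ} (hk₁ : k ≠ -2) (hk₂ : k ≠ -3 / 2) (p : Fin 6)
    {T : Fin 6 → 𝓢'(E3, ℂ)} (hT : ∀ a, IsGivenBy (𝓕 (T a))
      (fun η => ((symbol k ((2 * Real.pi) • η))⁻¹.mulVec (Pi.single p 1)) a)) :
    adjointOp k (symMat T) = symMat (Pi.single p (TemperedDistribution.delta (0 : E3))) := by
  ext i j φ
  -- Fourier inversion on Schwartz space: every test function is a transform, so the equation can be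
  -- tested on the Fourier side.
  obtain ⟨ψ, rfl⟩ : ∃ ψ : 𝓢(E3, ℂ), 𝓕 ψ = φ := ⟨𝓕⁻ φ, FourierTransform.fourier_fourierInv_eq φ⟩
  rw [adjointOp_eq_indexForm laplacian_tempered]
  let L : 𝓢'(E3, ℂ) →ₗ[ℝ] ℂ :=
    { toFun := fun S => S (𝓕 ψ)
      map_add' := fun _ _ => rfl
      map_smul' := fun _ _ => rfl }
  have h1 := map_indexForm L k (fun a b c d => -∂_{e a} (∂_{e b} (symMat T c d))) i j
  refine h1.trans ?_
  let g : Fin 6 → E3 → ℝ := fun a ξ => ((symbol k ξ)⁻¹.mulVec (Pi.single p 1)) a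
  let Y : Fin 3 → Fin 3 → Fin 3 → Fin 3 → ℂ × (E3 → ℂ) := fun a b c d =>
    ((-∂_{e a} (∂_{e b} (symMat T c d))) (𝓕 ψ), fun η : E3 =>
      ((((2 * Real.pi) • η) a * ((2 * Real.pi) • η) b : ℝ) : ℂ) *
        (symMat g c d ((2 * Real.pi) • η) * ψ η))
  have hTg : ∀ c d, IsGivenBy (𝓕 (symMat T c d)) (fun η => symMat g c d ((2 * Real.pi) • η)) := by
    intro c d
    fin_cases c <;> fin_cases d <;> exact hT _
  -- Carrying each value together with its integrand allows the contraction to pass under the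
  -- integral, with integrability of every term included.
  have hY := indexForm_mem integralPairs k (Y := Y)
    (fun a b c d => lineDeriv_lineDeriv_apply_fourier (hTg c d) a b ψ) i j
  have hfst := map_indexForm (LinearMap.fst ℝ ℂ (E3 → ℂ)) k Y i j
  have hsnd : ∀ η, (indexForm k Y i j).2 η =
      symMat (fun a => ∑ b, (symbol k ((2 * Real.pi) • η) a b : ℂ) *
        (g b ((2 * Real.pi) • η) * ψ η)) i j := by
    intro η
    have := map_indexForm ((LinearMap.proj (R := ℝ) (φ := fun _ : E3 => ℂ) η).comp
      (LinearMap.snd ℝ ℂ (E3 → ℂ))) k Y i j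
    refine this.trans ?_
    rw [← indexForm_symMat]
    congr 1
    funext a b c d
    rw [← symMat_map (fun f : E3 → ℝ => ((f ((2 * Real.pi) • η) : ℂ) * ψ η))]
    rfl
  refine hfst.symm.trans (hY.2.symm.trans ?_)
  have hne : ∀ᵐ x : E3, x ≠ 0 := by simp [ae_iff, measure_singleton]
  have hpt : ∀ᵐ η : E3, (indexForm k Y i j).2 η =
      symMat (Pi.single p (1 : ℂ)) i j * ψ η := by
    filter_upwards [hne] with η hη
    have hξ : (2 * Real.pi) • η ≠ 0 := smul_ne_zero (by positivity) hη
    rw [hsnd, symMat_map (fun z : ℂ => z * ψ η)]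
    congr 2
    funext a
    have h2 : ∑ b, symbol k ((2 * Real.pi) • η) a b * g b ((2 * Real.pi) • η) =
        (Pi.single p 1 : Fin 6 → ℝ) a := by
      have := congrFun (Matrix.mulVec_mulVec (Pi.single p 1) (symbol k ((2 * Real.pi) • η))
        (symbol k ((2 * Real.pi) • η))⁻¹) a
      rw [Matrix.mul_nonsing_inv _ (isUnit_det_symbol hk₁ hk₂ hξ), Matrix.one_mulVec] at this
      exact this
    simp only [← mul_assoc, ← Finset.sum_mul]
    congr 1
    have h3 : (Pi.single p 1 : Fin 6 → ℂ) a = ((Pi.single p 1 : Fin 6 → ℝ) a : ℂ) := by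
      simp only [Pi.single_apply]; split_ifs <;> simp
    rw [h3, ← h2]
    push_cast
    rfl
  rw [integral_congr_ae hpt, integral_const_mul]
  -- The remaining integral is the delta at the origin applied to `𝓕 ψ`.
  have h0 : ∫ η, ψ η = 𝓕 ψ 0 := by
    rw [SchwartzMap.fourier_coe, Real.fourier_eq]; simp
  rw [h0]
  fin_cases i <;> fin_cases j <;> fin_cases p <;> simp [symMat]

end LiquidCrystal

theorem mainTheorem3 (k : ℝ) (hk₁ : k ≠ -2) (hk₂ : k ≠ -3 / 2) :
    -- each component is a homogeneous quartic polynomial over `32π(2+k)(3+2k)r⁵`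
    (∀ p a, (LiquidCrystal.fundNum k p a).IsHomogeneous 4) ∧
    -- `D* F^{pq} = δ₀ e_{pq}` in the sense of distributions, for the six unit vectors `e_{pq}`
    (∀ p : Fin 6, ∃ T : Fin 6 → TemperedDistribution LiquidCrystal.E3 ℂ,
      (∀ a, LiquidCrystal.IsGivenBy (T a) (LiquidCrystal.fundSol k p a)) ∧
      LiquidCrystal.adjointOp k (LiquidCrystal.symMat T) =
        LiquidCrystal.symMat
          (Pi.single p (TemperedDistribution.delta (0 : LiquidCrystal.E3)))) ∧
    -- the 6×6 matrix `N*` is the Fourier symbol of `D*` on symmetric matrix fields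
    (∀ (Q : Fin 6 → SchwartzMap LiquidCrystal.E3 ℂ) (a : Fin 6) (η : LiquidCrystal.E3),
      FourierTransform.fourier
          (LiquidCrystal.adjointOp k (LiquidCrystal.symMat Q)
            (LiquidCrystal.pair a).1 (LiquidCrystal.pair a).2) η =
        ∑ b, (LiquidCrystal.symbol k ((2 * Real.pi) • η) a b : ℂ) *
          FourierTransform.fourier (Q b) η) ∧
    -- `N*(ξ)` is invertible for `ξ ≠ 0`, and its inverse is quartic over `(2+k)(3+2k)|ξ|⁶`
    (∀ ξ : LiquidCrystal.E3, ξ ≠ 0 → IsUnit (LiquidCrystal.symbol k ξ).det) ∧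
    (∃ H : Fin 6 → Fin 6 → MvPolynomial (Fin 3) ℝ,
      (∀ a p, (H a p).IsHomogeneous 4) ∧
      ∀ ξ : LiquidCrystal.E3, ξ ≠ 0 → ∀ a p, (LiquidCrystal.symbol k ξ)⁻¹ a p =
        MvPolynomial.eval (fun i => ξ i) (H a p) / ((2 + k) * (3 + 2 * k) * ‖ξ‖ ^ 6)) ∧
    -- the inverse Fourier transforms of `ξ^α / |ξ|⁶`, `|α| = 4`, up to permuting coordinates
    (∀ σ : Equiv.Perm (Fin 3),
      LiquidCrystal.IsFourierPair
        (fun x => -3 * x (σ 0) * x (σ 1) * (x (σ 1) ^ 2 + x (σ 2) ^ 2)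
          / (32 * Real.pi * ‖x‖ ^ 5))
        (fun ξ => ξ (σ 0) ^ 3 * ξ (σ 1) / ‖ξ‖ ^ 6) ∧
      LiquidCrystal.IsFourierPair
        (fun x => x (σ 1) * x (σ 2) * (2 * x (σ 0) ^ 2 - x (σ 1) ^ 2 - x (σ 2) ^ 2)
          / (32 * Real.pi * ‖x‖ ^ 5))
        (fun ξ => ξ (σ 0) ^ 2 * ξ (σ 1) * ξ (σ 2) / ‖ξ‖ ^ 6) ∧
      LiquidCrystal.IsFourierPair
        (fun x => 3 * (x (σ 1) ^ 2 + x (σ 2) ^ 2) ^ 2 / (32 * Real.pi * ‖x‖ ^ 5))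
        (fun ξ => ξ (σ 0) ^ 4 / ‖ξ‖ ^ 6) ∧
      LiquidCrystal.IsFourierPair
        (fun x => (3 * x (σ 0) ^ 2 * x (σ 1) ^ 2 + ‖x‖ ^ 2 * x (σ 2) ^ 2)
          / (32 * Real.pi * ‖x‖ ^ 5))
        (fun ξ => ξ (σ 0) ^ 2 * ξ (σ 1) ^ 2 / ‖ξ‖ ^ 6)) ∧
    -- the Fourier transform of `F^{pq}` is `(N*)⁻¹ e_{pq}`
    (∀ p a, LiquidCrystal.IsFourierPair (LiquidCrystal.fundSol k p a)
      (fun ξ => ((LiquidCrystal.symbol k ξ)⁻¹.mulVec (Pi.single p 1)) a)) ∧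
    -- for `k = 0` the solution `F^{pq}` is `1 / (4πr)` times the unit vector `e_{pq}`
    (∀ (p a : Fin 6) (x : LiquidCrystal.E3), x ≠ 0 →
      LiquidCrystal.fundSol 0 p a x =
        1 / (4 * Real.pi * ‖x‖) * (Pi.single p 1 : Fin 6 → ℝ) a) := by
  refine ⟨LiquidCrystal.isHomogeneous_fundNum k, fun p => ?_,
    LiquidCrystal.fourier_adjointOp k, fun ξ hξ => LiquidCrystal.isUnit_det_symbol hk₁ hk₂ hξ,
    ⟨LiquidCrystal.invNum k, LiquidCrystal.isHomogeneous_invNum k,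
      fun ξ hξ => LiquidCrystal.symbol_inv_apply hk₁ hk₂ hξ⟩,
    LiquidCrystal.isFourierPair_monomials, LiquidCrystal.isFourierPair_fundSol hk₁ hk₂,
    fun p a x hx => LiquidCrystal.fundSol_zero p a hx⟩
  choose T hT hT' using LiquidCrystal.isFourierPair_fundSol hk₁ hk₂ p
  exact ⟨T, hT, LiquidCrystal.adjointOp_eq_delta hk₁ hk₂ p hT'⟩
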